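/- Let $Q=\partial([0,1]^3)$ be the surface of the unit cube. A simple closed quasigeodesic on $Q$ is a closed polygonal curve on $Q$ without self-intersections that, at every one of its points, has surface angle at most $\pi$ to each side. A geodesic segment is a geodesic on $Q$ (surface angle exactly $\pi$ to each side at every interior point of the segment) that joins a vertex of the cube to a vertex of the cube (possibly the same one) and does not intersect itself, except that its two ends may coincide. It crosses a face once for each maximal subarc that runs through the relative interior of that face. Then every geodesic segment that is a component (an arc between consecutive vertices) of a simple closed quasigeodesic on $Q$ crosses no face of the cube more than once. -/

import Mathlib

noncomputable section

namespace Cube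

/-- Euclidean three-space. -/
abbrev E3 : Type := EuclideanSpace ℝ (Fin 3)

/-- `p` lies on one of the two planes `xᵢ = 0`, `xᵢ = 1`. -/
def OnWall (p : E3) (i : Fin 3) : Prop := p i = 0 ∨ p i = 1

/-- The surface of the unit cube `[0,1]³`. -/
def surface : Set E3 := {p | (∀ i, p i ∈ Set.Icc (0 : ℝ) 1) ∧ ∃ i, OnWall p i}

/-- The eight vertices of the cube. -/
def IsVertex (p : E3) : Prop := ∀ i, OnWall p i

/-- The relative interior of the face of the cube in the plane `xᵢ = 0` (for `c = false`) or
`xᵢ = 1` (for `c = true`). -/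
def openFace (i : Fin 3) (c : Bool) : Set E3 :=
  {p | p i = (if c then 1 else 0) ∧ ∀ j, j ≠ i → p j ∈ Set.Ioo (0 : ℝ) 1}

open Classical in
/-- The total surface angle at a point `p` of the surface of the cube. -/
def totalAngle (p : E3) : ℝ := if IsVertex p then 3 * Real.pi / 2 else 2 * Real.pi

open Classical in
/-- For a point `p` of the surface that is not a vertex, the isometric unfolding into the plane of
the tangent cone of the surface at `p`. At an interior point of an edge the coordinates of a
direction along the two walls through `p` are one nonnegative or nonpositive (according to the side
on which the cube lies) and one zero; the two half planes are laid flat on the two sides of the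
line that carries the edge. -/
def unfold (p w : E3) : ℂ :=
  if OnWall p 0 ∧ OnWall p 1 then ⟨w 2, |w 0| - |w 1|⟩
  else if OnWall p 1 ∧ OnWall p 2 then ⟨w 0, |w 1| - |w 2|⟩
  else if OnWall p 2 ∧ OnWall p 0 then ⟨w 1, |w 2| - |w 0|⟩
  else if OnWall p 0 then ⟨w 1, w 2⟩
  else if OnWall p 1 then ⟨w 2, w 0⟩
  else ⟨w 0, w 1⟩

open Classical in
/-- An angular coordinate, modulo `totalAngle p`, of a nonzero direction `w` that points from the
point `p` of the surface into the surface. At a vertex the three right-angled face corners are laid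
one after the other, each of them filling a quarter turn. -/
def angularCoord (p w : E3) : ℝ :=
  if IsVertex p then
    if w 2 = 0 then Complex.arg ⟨|w 0|, |w 1|⟩
    else if w 0 = 0 then Real.pi / 2 + Complex.arg ⟨|w 1|, |w 2|⟩
    else Real.pi + Complex.arg ⟨|w 2|, |w 0|⟩
  else Complex.arg (unfold p w)

/-- The surface angle at `p` of the sector that the directions `u` and `w` bound on one side. -/
def sideAngle (p u w : E3) : ℝ := |angularCoord p u - angularCoord p w|

/-- The surface angle at `p` of the sector that `u` and `w` bound on the other side. -/
def otherSideAngle (p u w : E3) : ℝ := totalAngle p - sideAngle p u w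

/-- Near `t`, for later parameters, `γ` runs straight from `γ t` in the unit direction `w`. -/
def HasForwardDir (γ : ℝ → E3) (t : ℝ) (w : E3) : Prop :=
  ‖w‖ = 1 ∧ ∃ ε > 0, ∀ s ∈ Set.Icc (0 : ℝ) ε, γ (t + s) = γ t + s • w

/-- Near `t`, for earlier parameters and traced backwards, `γ` runs straight from `γ t` in the unit
direction `u`. -/
def HasBackwardDir (γ : ℝ → E3) (t : ℝ) (u : E3) : Prop :=
  ‖u‖ = 1 ∧ ∃ ε > 0, ∀ s ∈ Set.Icc (0 : ℝ) ε, γ (t - s) = γ t + s • u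

/-- At the parameter `t` the curve has surface angle at most `π` to each side. -/
def IsQuasigeodesicAt (γ : ℝ → E3) (t : ℝ) : Prop :=
  ∃ u w, HasBackwardDir γ t u ∧ HasForwardDir γ t w ∧
    sideAngle (γ t) u w ≤ Real.pi ∧ otherSideAngle (γ t) u w ≤ Real.pi

/-- At the parameter `t` the curve has surface angle exactly `π` to each side. -/
def IsGeodesicAt (γ : ℝ → E3) (t : ℝ) : Prop :=
  ∃ u w, HasBackwardDir γ t u ∧ HasForwardDir γ t w ∧
    sideAngle (γ t) u w = Real.pi ∧ otherSideAngle (γ t) u w = Real.pi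

/-- A simple closed quasigeodesic of length `L` on the surface of the cube: a closed polygonal
curve, parametrized by arc length (`L`-periodically), without self-intersections, that has surface
angle at most `π` to each side at every point. -/
structure IsSimpleClosedQuasigeodesic (γ : ℝ → E3) (L : ℝ) : Prop where
  length_pos : 0 < L
  closed : Function.Periodic γ L
  simple : Set.InjOn γ (Set.Ico 0 L)
  on_surface : ∀ t, γ t ∈ surface
  angle_le : ∀ t, IsQuasigeodesicAt γ t

/-- The arc of `γ` over `[a, b]` is a geodesic segment: a geodesic on the surface of the cube from a
vertex to a vertex, without self-intersections. The two end vertices are allowed to coincide. -/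
structure IsGeodesicSegment (γ : ℝ → E3) (a b : ℝ) : Prop where
  lt : a < b
  on_surface : ∀ t ∈ Set.Icc a b, γ t ∈ surface
  start_vertex : IsVertex (γ a)
  end_vertex : IsVertex (γ b)
  start_dir : ∃ w, HasForwardDir γ a w
  end_dir : ∃ u, HasBackwardDir γ b u
  geodesic : ∀ t ∈ Set.Ioo a b, IsGeodesicAt γ t
  simple_left : Set.InjOn γ (Set.Ico a b)
  simple_right : Set.InjOn γ (Set.Ioc a b)

/-- The crossings of the face `(i, c)` by the arc of `γ` over `[a, b]`: the maximal parameter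
intervals during which the arc runs through the interior of the face. -/
def faceCrossings (γ : ℝ → E3) (a b : ℝ) (i : Fin 3) (c : Bool) : Set (Set ℝ) :=
  {I | ∃ t ∈ Set.Icc a b ∩ γ ⁻¹' openFace i c,
    I = connectedComponentIn (Set.Icc a b ∩ γ ⁻¹' openFace i c) t}

end Cube

end

namespace Cube
open Set

set_option linter.unusedSimpArgs false
set_option linter.unnecessarySeqFocus false

/-! Place the start vertex at the origin and roll the cube along the segment, so that the segment
becomes a straight ray in direction (A, B) through the unit squares of the lattice. By symmetry 0 ≤
B ≤ A. If B = 0, the segment is an edge and meets no open face. For slopes 1, 1/2, 2/3, 3/4, 1/3,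
2/5, 1/4 the ray reaches a lattice point, that is, a vertex of the cube, while all squares passed so
far still lie on different faces (`Node.corner`). A geodesic cannot go on through a vertex, so the
segment ends there and no face is crossed twice (`Trace.crossings_le_one`).

Every other slope is incompatible with a simple closed quasigeodesic. For slopes in (1/4, 1/3),
(1/3, 2/5) and (2/3, 3/4) the ray returns to a face it has crossed, turned by a right angle, and
meets its own earlier track transversally (`lin_eq`).

For slopes in (0, 1/4), (2/5, 1/2), (1/2, 2/3) and (3/4, 1) the ray winds around the cube as a
helix, and the start face comes back unturned, with an image of the start vertex below the ray. The
line from the origin to that image is the boundary of a strip under the helix. Now trace the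
quasigeodesic backwards out of the start vertex, drawn at its image. A vertex has total angle 3π/2
and each side has at most π, so the backward curve makes at least a right angle with (A, B) on both
sides. A backward ray inside the strip runs into the helix (`Trapped`), which simplicity forbids. A
backward ray along the boundary is forced from vertex to vertex back to the start, where it arrives
in a wrong direction. A backward ray below the boundary passes around a vertex or through the face
below, comes back turned by a right angle, and then hits the helix. These are the lemmas
`helix_four`, `helix_four_two`, `helix_two_four` and `helix_three_three`. -/

/-! ### Angle conditions as algebraic relations between directions. -/

/-- The symmetric form of the angle conditions at `p` between the directions `u` and `w`. -/
def Fold (p u w : E3) : Prop :=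
  ∀ i j k : Fin 3, i ≠ j → i ≠ k → j ≠ k →
    (OnWall p i → OnWall p j → ¬ OnWall p k → w k = -u k ∧ |w i| - |w j| = |u j| - |u i|) ∧
    (OnWall p i → ¬ OnWall p j → ¬ OnWall p k → w j = -u j ∧ w k = -u k) ∧
    (IsVertex p → (u k = 0 → w i = 0 → |u j| * |w j| ≤ |u i| * |w k|) ∧
      (u k = 0 → w k = 0 → |u i| * |w i| + |u j| * |w j| ≤ 0))

/-- The direction `w` points from `p` into the surface. -/
def Tang (p w : E3) : Prop :=
  (∀ i, p i = 0 → 0 ≤ w i) ∧ (∀ i, p i = 1 → w i ≤ 0) ∧ ∃ i, OnWall p i ∧ w i = 0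

/-- A curve on the surface that satisfies the angle conditions everywhere. -/
def Good (G : ℝ → E3) : Prop :=
  (∀ t, G t ∈ surface) ∧ ∀ t, ∃ u w, HasBackwardDir G t u ∧ HasForwardDir G t w ∧
    Tang (G t) u ∧ Tang (G t) w ∧ Fold (G t) u w

theorem Fold.symm {p u w : E3} (h : Fold p u w) : Fold p w u := by
  intro i j k hij hik hjk
  obtain ⟨h1, h2, h3⟩ := h i j k hij hik hjk
  obtain ⟨-, -, h4⟩ := h k j i hjk.symm hik.symm hij.symm
  refine ⟨fun a b c => ?_, fun a b c => ?_, fun a => ⟨fun b c => ?_, fun b c => ?_⟩⟩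
  · have := h1 a b c; constructor <;> linarith
  · have := h2 a b c; constructor <;> linarith
  · have := (h4 a).1 c b; linarith
  · have := (h3 a).2 c b; linarith

theorem hasBackwardDir_reverse {G : ℝ → E3} {a t : ℝ} {u : E3} :
    HasBackwardDir (fun s => G (a - s)) t u ↔ HasForwardDir G (a - t) u := by
  have : ∀ s, a - (t - s) = a - t + s := fun s => by ring
  simp only [HasBackwardDir, HasForwardDir, this]

theorem hasForwardDir_reverse {G : ℝ → E3} {a t : ℝ} {u : E3} :
    HasForwardDir (fun s => G (a - s)) t u ↔ HasBackwardDir G (a - t) u := by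
  have : ∀ s, a - (t + s) = a - t - s := fun s => by ring
  simp only [HasBackwardDir, HasForwardDir, this]

theorem Good.reverse {G : ℝ → E3} (h : Good G) (a : ℝ) : Good (fun s => G (a - s)) := by
  refine ⟨fun t => h.1 _, fun t => ?_⟩
  obtain ⟨u, w, h1, h2, h3, h4, h5⟩ := h.2 (a - t)
  exact ⟨w, u, hasBackwardDir_reverse.2 h2, hasForwardDir_reverse.2 h1, h4, h3, h5.symm⟩

theorem HasForwardDir.unique {G : ℝ → E3} {t : ℝ} {u w : E3} (hu : HasForwardDir G t u)
    (hw : HasForwardDir G t w) : u = w := by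
  obtain ⟨-, ε, hε, h1⟩ := hu
  obtain ⟨-, δ, hδ, h2⟩ := hw
  have hm : 0 < min ε δ := lt_min hε hδ
  have e1 := h1 (min ε δ) ⟨hm.le, min_le_left _ _⟩
  have e2 := h2 (min ε δ) ⟨hm.le, min_le_right _ _⟩
  rw [e1] at e2
  exact smul_right_injective _ hm.ne' (add_left_cancel e2)

theorem HasBackwardDir.unique {G : ℝ → E3} {t : ℝ} {u w : E3} (hu : HasBackwardDir G t u)
    (hw : HasBackwardDir G t w) : u = w := by
  obtain ⟨-, ε, hε, h1⟩ := hu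
  obtain ⟨-, δ, hδ, h2⟩ := hw
  have hm : 0 < min ε δ := lt_min hε hδ
  have e1 := h1 (min ε δ) ⟨hm.le, min_le_left _ _⟩
  have e2 := h2 (min ε δ) ⟨hm.le, min_le_right _ _⟩
  rw [e1] at e2
  exact smul_right_injective _ hm.ne' (add_left_cancel e2)

theorem Good.continuous {G : ℝ → E3} (h : Good G) : Continuous G := by
  rw [continuous_iff_continuousAt]
  intro t
  obtain ⟨u, w, ⟨-, ε, hε, h1⟩, ⟨-, δ, hδ, h2⟩, -⟩ := h.2 t
  rw [continuousAt_iff_continuous_left_right]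
  constructor
  · have hc : ContinuousWithinAt (fun s => G t + (t - s) • u) (Iic t) t := by fun_prop
    refine hc.congr_of_eventuallyEq ?_ (by simp)
    filter_upwards [self_mem_nhdsWithin,
      mem_nhdsWithin_of_mem_nhds (Ioi_mem_nhds (show t - ε < t by linarith))] with s hs hs'
    have hs : s ≤ t := hs
    have hs' : t - ε < s := hs'
    have := h1 (t - s) ⟨by linarith, by linarith⟩
    simpa using this
  · have hc : ContinuousWithinAt (fun s => G t + (s - t) • w) (Ici t) t := by fun_prop
    refine hc.congr_of_eventuallyEq ?_ (by simp)
    filter_upwards [self_mem_nhdsWithin,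
      mem_nhdsWithin_of_mem_nhds (Iio_mem_nhds (show t < t + δ by linarith))] with s hs hs'
    have hs : t ≤ s := hs
    have hs' : s < t + δ := hs'
    have := h2 (s - t) ⟨by linarith, by linarith⟩
    simpa using this

theorem abs_coord_le_norm (w : E3) (i : Fin 3) : |w i| ≤ ‖w‖ :=
  PiLp.norm_apply_le w i

theorem tang_of_forward {G : ℝ → E3} (hG : ∀ t, G t ∈ surface) {t : ℝ} {w : E3}
    (h : HasForwardDir G t w) : Tang (G t) w := by
  obtain ⟨hn, ε, hε, h⟩ := h
  have hle : ∀ i, |w i| ≤ 1 := fun i => hn ▸ abs_coord_le_norm w i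
  have hS : ∀ s ∈ Icc 0 ε, (∀ i, G t i + s * w i ∈ Icc (0 : ℝ) 1) ∧
      ∃ i, G t i + s * w i = 0 ∨ G t i + s * w i = 1 := by
    intro s hs
    have := hG (t + s)
    rw [h s hs] at this
    simpa [surface, OnWall] using this
  refine ⟨fun i hi => ?_, fun i hi => ?_, ?_⟩
  · have := ((hS ε ⟨hε.le, le_rfl⟩).1 i).1
    rw [hi, zero_add] at this
    exact nonneg_of_mul_nonneg_right this hε
  · have := ((hS ε ⟨hε.le, le_rfl⟩).1 i).2
    rw [hi] at this
    nlinarith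
  · have hd : ∃ δ > 0, ∀ i, ¬ OnWall (G t) i → δ < G t i ∧ δ < 1 - G t i := by
      have h1 : ∀ i, ∃ δ > 0, ¬ OnWall (G t) i → δ < G t i ∧ δ < 1 - G t i := by
        intro i
        by_cases hw : OnWall (G t) i
        · exact ⟨1, one_pos, fun h => absurd hw h⟩
        · have hi := (hG t).1 i
          have h0 : 0 < G t i := lt_of_le_of_ne hi.1 fun e => hw (Or.inl e.symm)
          have h1 : G t i < 1 := lt_of_le_of_ne hi.2 fun e => hw (Or.inr e)
          refine ⟨min (G t i) (1 - G t i) / 2, by have := lt_min h0 (sub_pos.2 h1); linarith,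
            fun _ => ⟨?_, ?_⟩⟩
          · have := min_le_left (G t i) (1 - G t i); linarith
          · have := min_le_right (G t i) (1 - G t i); linarith
      choose δ hδ hδ' using h1
      refine ⟨min (δ 0) (min (δ 1) (δ 2)), by simp [hδ], fun i hi => ?_⟩
      have hm : min (δ 0) (min (δ 1) (δ 2)) ≤ δ i := by fin_cases i <;> simp
      exact ⟨hm.trans_lt (hδ' i hi).1, hm.trans_lt (hδ' i hi).2⟩
    obtain ⟨δ, hδ, hd⟩ := hd
    -- The step stays on the straight piece, is too short for a coordinate off the walls to reach
    -- one, and too short to pass from one wall to the opposite one. So the wall occupied after the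
    -- step was occupied before it and the direction runs along it.
    set s := min ε (min δ (1 / 2)) with hs
    have s0 : 0 < s := by simp [hs, hε, hδ]
    have s1 : s ≤ ε := min_le_left _ _
    have s2 : s ≤ δ := (min_le_right _ _).trans (min_le_left _ _)
    have s3 : s ≤ 1 / 2 := (min_le_right _ _).trans (min_le_right _ _)
    obtain ⟨-, i, hi⟩ := hS s ⟨s0.le, s1⟩
    have hb := abs_le.1 (hle i)
    by_cases hw : OnWall (G t) i
    · refine ⟨i, hw, ?_⟩
      by_contra hne
      rcases hw with hw | hw <;> rw [hw] at hi <;> rcases hi with hi | hi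
      · simp [s0.ne', hne] at hi
      · nlinarith
      · nlinarith
      · simp [s0.ne', hne] at hi
    · have := hd i hw
      rcases hi with hi | hi <;> nlinarith

theorem tang_of_backward {G : ℝ → E3} (hG : ∀ t, G t ∈ surface) {t : ℝ} {w : E3}
    (h : HasBackwardDir G t w) : Tang (G t) w := by
  have := tang_of_forward (G := fun s => G (t - s)) (fun s => hG _) (t := 0) (w := w)
    (hasForwardDir_reverse.2 (by simpa using h))
  simpa using this

theorem sq_norm_eq (w : E3) : ‖w‖ ^ 2 = w 0 ^ 2 + w 1 ^ 2 + w 2 ^ 2 := by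
  simp [EuclideanSpace.norm_sq_eq, Fin.sum_univ_three]

theorem unfold_edge {p : E3} {i j k : Fin 3} (hij : i ≠ j) (hik : i ≠ k) (hjk : j ≠ k)
    (hi : OnWall p i) (hj : OnWall p j) (hk : ¬ OnWall p k) :
    (∀ w, unfold p w = ⟨w k, |w i| - |w j|⟩) ∨ ∀ w, unfold p w = ⟨w k, |w j| - |w i|⟩ := by
  fin_cases i <;> fin_cases j <;> fin_cases k <;> simp_all [unfold]

theorem unfold_face {p : E3} {i j k : Fin 3} (hij : i ≠ j) (hik : i ≠ k) (hjk : j ≠ k)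
    (hi : OnWall p i) (hj : ¬ OnWall p j) (hk : ¬ OnWall p k) :
    (∀ w, unfold p w = ⟨w j, w k⟩) ∨ ∀ w, unfold p w = ⟨w k, w j⟩ := by
  fin_cases i <;> fin_cases j <;> fin_cases k <;> simp_all [unfold]

theorem sq_sum_perm (w : E3) {i j k : Fin 3} (hij : i ≠ j) (hik : i ≠ k) (hjk : j ≠ k) :
    w 0 ^ 2 + w 1 ^ 2 + w 2 ^ 2 = w i ^ 2 + w j ^ 2 + w k ^ 2 := by
  fin_cases i <;> fin_cases j <;> fin_cases k <;> simp_all <;> ring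

/-- A direction into the surface lies in one of the walls through p, so at an edge one of the two
wall coordinates vanishes and (|wᵢ| - |wⱼ|)² = wᵢ² + wⱼ². -/
theorem norm_unfold {p w : E3} {i j k : Fin 3} (hij : i ≠ j) (hik : i ≠ k) (hjk : j ≠ k)
    (hi : OnWall p i) (hk : ¬ OnWall p k) (hw : Tang p w) : ‖unfold p w‖ = ‖w‖ := by
  have h := sq_norm_eq w
  rw [sq_sum_perm w hij hik hjk] at h
  rw [← sq_eq_sq₀ (norm_nonneg _) (norm_nonneg _), h, ← Complex.normSq_eq_norm_sq,
    Complex.normSq_apply]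
  obtain ⟨-, -, l, hl, hl0⟩ := hw
  have hl' : l = i ∨ l = j ∨ l = k := by
    revert hij hik hjk; clear hi hk hl0 hl h; revert i j k l; decide
  by_cases hj : OnWall p j
  · have hz : |w i| * |w j| = 0 := by
      rcases hl' with rfl | rfl | rfl
      · simp [hl0]
      · simp [hl0]
      · exact absurd hl hk
    rcases unfold_edge hij hik hjk hi hj hk with e | e <;> rw [e] <;> simp only <;>
      nlinarith [sq_abs (w i), sq_abs (w j)]
  · have hz : w i = 0 := by
      rcases hl' with rfl | rfl | rfl
      · exact hl0
      · exact absurd hl hj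
      · exact absurd hl hk
    rcases unfold_face hij hik hjk hi hj hk with e | e <;> rw [e] <;> simp only [hz] <;> ring

theorem unfold_eq_neg {p u w : E3} (hp : ¬ IsVertex p) (hs : sideAngle p u w = Real.pi)
    (hu : ‖unfold p u‖ = 1) (hw : ‖unfold p w‖ = 1) : unfold p w = -unfold p u := by
  simp only [sideAngle, angularCoord, hp, if_false] at hs
  rw [← Complex.norm_mul_exp_arg_mul_I (unfold p u), ← Complex.norm_mul_exp_arg_mul_I (unfold p w),
    hu, hw]
  rcases (abs_eq Real.pi_pos.le).1 hs with h | h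
  · have : (unfold p u).arg = (unfold p w).arg + Real.pi := by linarith
    rw [this]
    push_cast
    rw [add_mul, Complex.exp_add, Complex.exp_pi_mul_I]
    ring
  · have : (unfold p w).arg = (unfold p u).arg + Real.pi := by linarith
    rw [this]
    push_cast
    rw [add_mul, Complex.exp_add, Complex.exp_pi_mul_I]
    ring

theorem exists_angle {x y : ℝ} (hx : 0 ≤ x) (hy : 0 ≤ y) (h : x ^ 2 + y ^ 2 = 1) :
    Complex.arg ⟨x, y⟩ ∈ Icc 0 (Real.pi / 2) ∧ x = Real.cos (Complex.arg ⟨x, y⟩) ∧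
      y = Real.sin (Complex.arg ⟨x, y⟩) := by
  have hn : ‖(⟨x, y⟩ : ℂ)‖ = 1 := by
    rw [Complex.norm_def, Complex.normSq_apply, Real.sqrt_eq_one]; simp only; nlinarith
  have h0 : (⟨x, y⟩ : ℂ) ≠ 0 := fun e => by rw [e] at hn; simp at hn
  refine ⟨⟨Complex.arg_nonneg_iff.2 hy, Complex.arg_le_pi_div_two_iff.2 (Or.inl hx)⟩, ?_, ?_⟩
  · rw [Complex.cos_arg h0, hn]; simp
  · rw [Complex.sin_arg, hn]; simp

/-- The position of a corner direction among the three face corners laid in sequence. -/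
theorem angularCoord_corner {p w : E3} (hp : IsVertex p) (hw : Tang p w) (hn : ‖w‖ = 1) :
    ∃ α ∈ Icc 0 (Real.pi / 2),
      (w 2 = 0 ∧ |w 0| = Real.cos α ∧ |w 1| = Real.sin α ∧ angularCoord p w = α) ∨
      (w 0 = 0 ∧ |w 1| = Real.cos α ∧ |w 2| = Real.sin α ∧ angularCoord p w = Real.pi / 2 + α) ∨
      (w 1 = 0 ∧ |w 2| = Real.cos α ∧ |w 0| = Real.sin α ∧ angularCoord p w = Real.pi + α) := by
  have h := sq_norm_eq w
  rw [hn] at h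
  simp only [angularCoord, hp, if_true]
  obtain ⟨-, -, l, -, hl⟩ := hw
  by_cases h2 : w 2 = 0
  · obtain ⟨h3, h4, h5⟩ := exists_angle (abs_nonneg (w 0)) (abs_nonneg (w 1))
      (by rw [sq_abs, sq_abs]; rw [h2] at h; linarith)
    exact ⟨_, h3, Or.inl ⟨h2, h4, h5, by simp [h2]⟩⟩
  by_cases h0 : w 0 = 0
  · obtain ⟨h3, h4, h5⟩ := exists_angle (abs_nonneg (w 1)) (abs_nonneg (w 2))
      (by rw [sq_abs, sq_abs]; rw [h0] at h; linarith)
    exact ⟨_, h3, Or.inr (Or.inl ⟨h0, h4, h5, by simp [h2, h0]⟩)⟩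
  have h1 : w 1 = 0 := by
    fin_cases l
    · exact absurd hl h0
    · exact hl
    · exact absurd hl h2
  obtain ⟨h3, h4, h5⟩ := exists_angle (abs_nonneg (w 2)) (abs_nonneg (w 0))
    (by rw [sq_abs, sq_abs]; rw [h1] at h; linarith)
  exact ⟨_, h3, Or.inr (Or.inr ⟨h1, h4, h5, by simp [h2, h0]⟩)⟩

/-- Since the total angle is 3π/2, a bound π on one side is a lower bound π/2 on the other. Addition
formulas for sine and cosine turn these bounds into inequalities between products of coordinates. -/
theorem corner_pairs_aux {p u w : E3} (hp : IsVertex p) (hu : Tang p u) (hw : Tang p w)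
    (hun : ‖u‖ = 1) (hwn : ‖w‖ = 1) (h1 : sideAngle p u w ≤ Real.pi)
    (h2 : otherSideAngle p u w ≤ Real.pi) :
    ∃ i j k : Fin 3, i ≠ j ∧ i ≠ k ∧ j ≠ k ∧
    ((u k = 0 ∧ w i = 0 ∧ |u j| * |w j| ≤ |u i| * |w k|) ∨
      (u k = 0 ∧ w k = 0 ∧ |u i| * |w i| + |u j| * |w j| ≤ 0)) := by
  obtain ⟨α, ⟨ha0, ha1⟩, ha⟩ := angularCoord_corner hp hu hun
  obtain ⟨β, ⟨hb0, hb1⟩, hb⟩ := angularCoord_corner hp hw hwn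
  have hpi := Real.pi_pos
  simp only [otherSideAngle, totalAngle, hp, if_true] at h2
  have h2 : Real.pi / 2 ≤ sideAngle p u w := by linarith
  simp only [sideAngle] at h1 h2
  have same : Real.pi / 2 ≤ |α - β| → Real.cos α * Real.cos β + Real.sin α * Real.sin β ≤ 0 := by
    intro h
    rw [← Real.cos_sub, ← Real.cos_abs]
    exact Real.cos_nonpos_of_pi_div_two_le_of_le h
      ((abs_le.2 ⟨by linarith, by linarith⟩ : |α - β| ≤ Real.pi / 2).trans (by linarith))
  have le : α ≤ β → Real.sin α * Real.cos β ≤ Real.cos α * Real.sin β := by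
    intro h
    have := Real.sin_nonneg_of_nonneg_of_le_pi (sub_nonneg.2 h) (by linarith)
    rw [Real.sin_sub] at this
    linarith
  have ge : β ≤ α → Real.sin β * Real.cos α ≤ Real.cos β * Real.sin α := by
    intro h
    have := Real.sin_nonneg_of_nonneg_of_le_pi (sub_nonneg.2 h) (by linarith)
    rw [Real.sin_sub] at this
    linarith
  have hd := le_abs.1 h2
  have hd' := abs_le.1 h1
  -- Consecutive quarters use the lower bound π/2 on the difference of coordinates. The first and
  -- the third quarter meet across the cut of the angular coordinate; there the upper bound π is the
  -- one that counts.
  rcases ha with ⟨ua, ub, uc, ud⟩ | ⟨ua, ub, uc, ud⟩ | ⟨ua, ub, uc, ud⟩ <;>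
  rcases hb with ⟨wa, wb, wc, wd⟩ | ⟨wa, wb, wc, wd⟩ | ⟨wa, wb, wc, wd⟩ <;>
  rw [ud, wd] at hd hd' h2
  · exact ⟨0, 1, 2, by decide, by decide, by decide, Or.inr ⟨ua, wa, by
      rw [ub, uc, wb, wc]; exact same h2⟩⟩
  · exact ⟨0, 1, 2, by decide, by decide, by decide, Or.inl ⟨ua, wa, by
      rw [ub, uc, wb, wc]; exact le (by rcases hd with h | h <;> linarith)⟩⟩
  · exact ⟨1, 0, 2, by decide, by decide, by decide, Or.inl ⟨ua, wa, by
      rw [ub, uc, wb, wc]; have := ge (by linarith); linarith⟩⟩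
  · exact ⟨2, 1, 0, by decide, by decide, by decide, Or.inl ⟨ua, wa, by
      rw [ub, uc, wb, wc]; have := ge (by rcases hd with h | h <;> linarith); linarith⟩⟩
  · exact ⟨1, 2, 0, by decide, by decide, by decide, Or.inr ⟨ua, wa, by
      rw [ub, uc, wb, wc]; exact same (by rwa [add_sub_add_left_eq_sub] at h2)⟩⟩
  · exact ⟨1, 2, 0, by decide, by decide, by decide, Or.inl ⟨ua, wa, by
      rw [ub, uc, wb, wc]; exact le (by rcases hd with h | h <;> linarith)⟩⟩
  · exact ⟨2, 0, 1, by decide, by decide, by decide, Or.inl ⟨ua, wa, by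
      rw [ub, uc, wb, wc]; exact le (by linarith)⟩⟩
  · exact ⟨0, 2, 1, by decide, by decide, by decide, Or.inl ⟨ua, wa, by
      rw [ub, uc, wb, wc]; have := ge (by rcases hd with h | h <;> linarith); linarith⟩⟩
  · exact ⟨2, 0, 1, by decide, by decide, by decide, Or.inr ⟨ua, wa, by
      rw [ub, uc, wb, wc]; exact same (by rwa [add_sub_add_left_eq_sub] at h2)⟩⟩

/-- Half plane description of two directions at a corner that enclose at least a right angle. -/
theorem corner_pairs {p u w : E3} (hp : IsVertex p) (hu : Tang p u) (hw : Tang p w)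
    (hun : ‖u‖ = 1) (hwn : ‖w‖ = 1) (h1 : sideAngle p u w ≤ Real.pi)
    (h2 : otherSideAngle p u w ≤ Real.pi) (i j k : Fin 3) (hij : i ≠ j) (hik : i ≠ k)
    (hjk : j ≠ k) :
    (u k = 0 → w i = 0 → |u j| * |w j| ≤ |u i| * |w k|) ∧
      (u k = 0 → w k = 0 → |u i| * |w i| + |u j| * |w j| ≤ 0) := by
  obtain ⟨i', j', k', h12, h13, h23, h⟩ := corner_pairs_aux hp hu hw hun hwn h1 h2
  have hu2 := sq_norm_eq u
  have hw2 := sq_norm_eq w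
  rw [hun, sq_sum_perm u hij hik hjk] at hu2
  rw [hwn, sq_sum_perm w hij hik hjk] at hw2
  have pi' : (i' = i ∧ j' = j ∧ k' = k) ∨ (i' = i ∧ j' = k ∧ k' = j) ∨ (i' = j ∧ j' = i ∧ k' = k) ∨
      (i' = j ∧ j' = k ∧ k' = i) ∨ (i' = k ∧ j' = i ∧ k' = j) ∨ (i' = k ∧ j' = j ∧ k' = i) := by
    clear h hu2 hw2; revert i j k i' j' k'; decide
  have a1 := abs_nonneg (u i)
  have a2 := abs_nonneg (u j)
  have a3 := abs_nonneg (u k)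
  have b1 := abs_nonneg (w i)
  have b2 := abs_nonneg (w j)
  have b3 := abs_nonneg (w k)
  simp only [← abs_eq_zero (a := u _), ← abs_eq_zero (a := w _)] at h ⊢
  rcases pi' with ⟨rfl, rfl, rfl⟩ | ⟨rfl, rfl, rfl⟩ | ⟨rfl, rfl, rfl⟩ | ⟨rfl, rfl, rfl⟩ |
    ⟨rfl, rfl, rfl⟩ | ⟨rfl, rfl, rfl⟩ <;>
  rcases h with ⟨e1, e2, e3⟩ | ⟨e1, e2, e3⟩ <;>
  refine ⟨fun f1 f2 => ?_, fun f1 f2 => ?_⟩ <;>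
  (try simp only [e1, e2, f1, f2, mul_zero, zero_mul, add_zero, zero_add, le_refl] at e3 ⊢) <;>
  first
  | exact e3
  | positivity
  | nlinarith

/-- Off the vertices the two side angles add up to 2π, so both equal π and the unfolded directions
are opposite. -/
theorem IsQuasigeodesicAt.fold {γ : ℝ → E3} (hs : ∀ t, γ t ∈ surface) {t : ℝ}
    (h : IsQuasigeodesicAt γ t) : ∃ u w, HasBackwardDir γ t u ∧ HasForwardDir γ t w ∧
      Tang (γ t) u ∧ Tang (γ t) w ∧ Fold (γ t) u w := by
  obtain ⟨u, w, hu, hw, h1, h2⟩ := h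
  have tu := tang_of_backward hs hu
  have tw := tang_of_forward hs hw
  refine ⟨u, w, hu, hw, tu, tw, fun i j k hij hik hjk => ?_⟩
  have key : ∀ i j k : Fin 3, i ≠ j → i ≠ k → j ≠ k → OnWall (γ t) i → ¬ OnWall (γ t) k →
      unfold (γ t) w = -unfold (γ t) u := by
    intro i j k hij hik hjk hi hk
    have hv : ¬ IsVertex (γ t) := fun hv => hk (hv k)
    simp only [otherSideAngle, totalAngle, hv, if_false] at h2
    exact unfold_eq_neg hv (le_antisymm h1 (by linarith))
      ((norm_unfold hij hik hjk hi hk tu).trans hu.1)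
      ((norm_unfold hij hik hjk hi hk tw).trans hw.1)
  refine ⟨fun hi hj hk => ?_, fun hi hj hk => ?_,
    fun hv => corner_pairs hv tu tw hu.1 hw.1 h1 h2 i j k hij hik hjk⟩
  · have e := key i j k hij hik hjk hi hk
    rcases unfold_edge hij hik hjk hi hj hk with e' | e' <;> rw [e', e', Complex.ext_iff] at e <;>
      simp only [Complex.neg_re, Complex.neg_im] at e <;>
      exact ⟨e.1, by linarith [e.2]⟩
  · have e := key i j k hij hik hjk hi hk
    rcases unfold_face hij hik hjk hi hj hk with e' | e' <;> rw [e', e', Complex.ext_iff] at e <;>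
      simp only [Complex.neg_re, Complex.neg_im] at e
    · exact e
    · exact ⟨e.2, e.1⟩

theorem IsSimpleClosedQuasigeodesic.good {γ : ℝ → E3} {L : ℝ}
    (h : IsSimpleClosedQuasigeodesic γ L) : Good γ :=
  ⟨h.on_surface, fun t => (h.angle_le t).fold h.on_surface⟩

/-! ### Consequences of simplicity. -/

/-- Two passages of a simple closed quasigeodesic through a point agree. -/
theorem IsSimpleClosedQuasigeodesic.shift {γ : ℝ → E3} {L : ℝ}
    (h : IsSimpleClosedQuasigeodesic γ L) {t t' : ℝ} (e : γ t = γ t') (s : ℝ) :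
    γ (t + s) = γ (t' + s) := by
  have hL := h.length_pos
  have h1 : γ (toIcoMod hL 0 t) = γ (toIcoMod hL 0 t') := by
    rw [toIcoMod, toIcoMod, h.closed.sub_zsmul_eq, h.closed.sub_zsmul_eq, e]
  have h2 := h.simple (by simpa using toIcoMod_mem_Ico hL 0 t)
    (by simpa using toIcoMod_mem_Ico hL 0 t') h1
  have e1 := toIcoMod_add_toIcoDiv_zsmul hL 0 t
  have e2 := toIcoMod_add_toIcoDiv_zsmul hL 0 t'
  have : t + s = t' + s - (toIcoDiv hL 0 t' - toIcoDiv hL 0 t) • L := by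
    rw [sub_smul]
    linarith
  rw [this, h.closed.sub_zsmul_eq]

theorem IsSimpleClosedQuasigeodesic.forward_unique {γ : ℝ → E3} {L : ℝ}
    (h : IsSimpleClosedQuasigeodesic γ L) {t t' : ℝ} (e : γ t = γ t') {w w' : E3}
    (hw : HasForwardDir γ t w) (hw' : HasForwardDir γ t' w') : w = w' := by
  refine hw.unique ⟨hw'.1, ?_⟩
  obtain ⟨ε, hε, h'⟩ := hw'.2
  exact ⟨ε, hε, fun s hs => by rw [h.shift e, e, h' s hs]⟩

theorem IsSimpleClosedQuasigeodesic.backward_of_eq {γ : ℝ → E3} {L : ℝ}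
    (h : IsSimpleClosedQuasigeodesic γ L) {t t' : ℝ} (e : γ t = γ t') {w : E3}
    (hw : HasBackwardDir γ t' w) : HasBackwardDir γ t w := by
  obtain ⟨hn, ε, hε, h'⟩ := hw
  exact ⟨hn, ε, hε, fun s hs => by rw [sub_eq_add_neg, h.shift e, ← sub_eq_add_neg, e, h' s hs]⟩

/-! ### Unit squares placed on the faces, and rolling the cube. -/

/-- A coordinate that runs from the wall `b` to the opposite wall. -/
def val (b : Bool) (x : ℝ) : ℝ := if b then 1 - x else x

/-- The sign of the inward direction at the wall `b`. -/
def sg (b : Bool) : ℝ := if b then -1 else 1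

/-- A placement of the unit square on a face: the axes of the two coordinates, the axis normal to
the face, and the walls on which the coordinates start. -/
structure Frame where
  (i j k : Fin 3)
  (bi bj bk : Bool)
  hij : i ≠ j
  hik : i ≠ k
  hjk : j ≠ k

namespace Frame

def chart (f : Frame) (x y : ℝ) : E3 := WithLp.toLp 2 fun l =>
  if l = f.i then val f.bi x else if l = f.j then val f.bj y else val f.bk 0

def lin (f : Frame) (a b : ℝ) : E3 := WithLp.toLp 2 fun l =>
  if l = f.i then sg f.bi * a else if l = f.j then sg f.bj * b else 0

/-- The neighbour across the edge x = 1 lies on the wall opposite to `bi`, and its first coordinate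
runs along the former normal: the two squares lie flat side by side. -/
def rollE (f : Frame) : Frame := ⟨f.k, f.j, f.i, f.bk, f.bj, !f.bi, f.hjk.symm, f.hik.symm, f.hij.symm⟩
def rollN (f : Frame) : Frame := ⟨f.i, f.k, f.j, f.bi, f.bk, !f.bj, f.hik, f.hij, f.hjk.symm⟩
def swap (f : Frame) : Frame := ⟨f.j, f.i, f.k, f.bj, f.bi, f.bk, f.hij.symm, f.hjk, f.hik⟩
def flipX (f : Frame) : Frame := ⟨f.i, f.j, f.k, !f.bi, f.bj, f.bk, f.hij, f.hik, f.hjk⟩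
-- The squares `f`, `f.rot`, `f.rot.rot` are the three faces around the common corner (0, 0), in
-- cyclic order.
def rot (f : Frame) : Frame := ⟨f.j, f.k, f.i, f.bj, f.bk, f.bi, f.hjk, f.hij.symm, f.hik.symm⟩

variable (f : Frame)

@[simp] theorem chart_i (x y : ℝ) : f.chart x y f.i = val f.bi x := by simp [chart]
@[simp] theorem chart_j (x y : ℝ) : f.chart x y f.j = val f.bj y := by simp [chart, f.hij.symm]
@[simp] theorem chart_k (x y : ℝ) : f.chart x y f.k = val f.bk 0 := by
  simp [chart, f.hik.symm, f.hjk.symm]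
@[simp] theorem lin_i (x y : ℝ) : f.lin x y f.i = sg f.bi * x := by simp [lin]
@[simp] theorem lin_j (x y : ℝ) : f.lin x y f.j = sg f.bj * y := by simp [lin, f.hij.symm]
@[simp] theorem lin_k (x y : ℝ) : f.lin x y f.k = 0 := by
  simp [lin, f.hik.symm, f.hjk.symm]

theorem cover (l : Fin 3) : l = f.i ∨ l = f.j ∨ l = f.k := by
  have h1 := f.hij; have h2 := f.hik; have h3 := f.hjk
  generalize f.i = i at *; generalize f.j = j at *; generalize f.k = k at *
  revert i j k l; decide

theorem ext_coord {p q : E3} (hi : p f.i = q f.i) (hj : p f.j = q f.j) (hk : p f.k = q f.k) :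
    p = q := by
  ext l
  rcases f.cover l with rfl | rfl | rfl <;> assumption

end Frame

theorem val_add (b : Bool) (x y : ℝ) : val b (x + y) = val b x + sg b * y := by
  cases b <;> simp only [val, sg] <;> simp <;> ring

theorem val_not (b : Bool) (x : ℝ) : val (!b) x = val b (1 - x) := by cases b <;> simp [val]

theorem sg_not (b : Bool) : sg (!b) = -sg b := by cases b <;> simp [sg]

theorem sg_mul_self (b : Bool) : sg b * sg b = 1 := by cases b <;> simp [sg]

theorem abs_sg (b : Bool) : |sg b| = 1 := by cases b <;> simp [sg]

theorem sg_ne_zero (b : Bool) : sg b ≠ 0 := by cases b <;> simp [sg]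

theorem val_wall {b : Bool} {x : ℝ} : (val b x = 0 ∨ val b x = 1) ↔ (x = 0 ∨ x = 1) := by
  cases b <;> simp [val]
  constructor <;> rintro (h | h) <;> first | (left; linarith) | (right; linarith)

namespace Frame
variable (f : Frame)

theorem chart_add (x y a b s : ℝ) : f.chart (x + s * a) (y + s * b) = f.chart x y + s • f.lin a b := by
  apply f.ext_coord <;> simp [val_add, mul_left_comm]

theorem lin_neg (a b : ℝ) : f.lin (-a) (-b) = -f.lin a b := by
  apply f.ext_coord <;> simp

theorem sq_norm (w : E3) : ‖w‖ ^ 2 = w f.i ^ 2 + w f.j ^ 2 + w f.k ^ 2 :=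
  (sq_norm_eq w).trans (sq_sum_perm w f.hij f.hik f.hjk)

theorem norm_lin {a b : ℝ} : ‖f.lin a b‖ = 1 ↔ a ^ 2 + b ^ 2 = 1 := by
  have h := f.sq_norm (f.lin a b)
  simp only [lin_i, lin_j, lin_k, mul_pow, sq (sg _), sg_mul_self] at h
  rw [← sq_eq_sq₀ (norm_nonneg _) one_pos.le, h]
  ring_nf

theorem lin_injective {a b a' b' : ℝ} (h : f.lin a b = f.lin a' b') : a = a' ∧ b = b' := by
  have h1 := congrArg (fun p : E3 => p f.i) h
  have h2 := congrArg (fun p : E3 => p f.j) h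
  simpa [sg_ne_zero] using And.intro h1 h2

theorem onWall_i {x y : ℝ} : OnWall (f.chart x y) f.i ↔ (x = 0 ∨ x = 1) := by
  simp [OnWall, val_wall]
theorem onWall_j {x y : ℝ} : OnWall (f.chart x y) f.j ↔ (y = 0 ∨ y = 1) := by
  simp [OnWall, val_wall]
theorem onWall_k {x y : ℝ} : OnWall (f.chart x y) f.k := by
  simp [OnWall, val_wall]

theorem isVertex_chart {x y : ℝ} :
    IsVertex (f.chart x y) ↔ (x = 0 ∨ x = 1) ∧ (y = 0 ∨ y = 1) := by
  constructor
  · exact fun h => ⟨f.onWall_i.1 (h _), f.onWall_j.1 (h _)⟩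
  · rintro ⟨h1, h2⟩ l
    rcases f.cover l with rfl | rfl | rfl
    exacts [f.onWall_i.2 h1, f.onWall_j.2 h2, f.onWall_k]

theorem mem_openFace {x y : ℝ} (hx : x ∈ Icc (0 : ℝ) 1) (hy : y ∈ Icc (0 : ℝ) 1) {i : Fin 3}
    {c : Bool} : f.chart x y ∈ openFace i c ↔
      i = f.k ∧ c = f.bk ∧ x ∈ Ioo (0 : ℝ) 1 ∧ y ∈ Ioo (0 : ℝ) 1 := by
  have hV : ∀ (b : Bool) (z : ℝ), z ∈ Icc (0 : ℝ) 1 → (val b z ∈ Ioo (0 : ℝ) 1 ↔ z ∈ Ioo (0 : ℝ) 1) := by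
    intro b z hz
    cases b <;> simp only [val, mem_Ioo] <;> simp <;> tauto
  have hk : ∀ b : Bool, val b 0 = if b then 1 else 0 := by intro b; cases b <;> simp [val]
  constructor
  · rintro ⟨h1, h2⟩
    have hik : i = f.k := by
      by_contra h
      have := h2 f.k (Ne.symm h)
      rw [chart_k, hk] at this
      split_ifs at this <;> simp at this
    subst hik
    refine ⟨rfl, ?_, ?_, ?_⟩
    · rw [chart_k, hk] at h1
      cases c <;> cases hb : f.bk <;> simp [hb] at h1 ⊢
    · have := h2 f.i f.hik; rw [chart_i] at this; exact (hV _ _ hx).1 this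
    · have := h2 f.j f.hjk; rw [chart_j] at this; exact (hV _ _ hy).1 this
  · rintro ⟨rfl, rfl, h1, h2⟩
    refine ⟨by rw [chart_k, hk], fun l hl => ?_⟩
    rcases f.cover l with rfl | rfl | rfl
    · rw [chart_i]; exact (hV _ _ hx).2 h1
    · rw [chart_j]; exact (hV _ _ hy).2 h2
    · exact absurd rfl hl

theorem chart_swap (x y : ℝ) : f.swap.chart x y = f.chart y x := by
  apply f.ext_coord <;> simp [chart, swap, f.hij, f.hij.symm, f.hik.symm, f.hjk.symm]
theorem lin_swap (x y : ℝ) : f.swap.lin x y = f.lin y x := by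
  apply f.ext_coord <;> simp [lin, swap, f.hij, f.hij.symm, f.hik.symm, f.hjk.symm]
theorem chart_flipX (x y : ℝ) : f.flipX.chart x y = f.chart (1 - x) y := by
  apply f.ext_coord <;> simp [chart, flipX, val_not, f.hij.symm, f.hik.symm, f.hjk.symm]
theorem lin_flipX (x y : ℝ) : f.flipX.lin x y = f.lin (-x) y := by
  apply f.ext_coord <;> simp [lin, flipX, sg_not, f.hij.symm, f.hik.symm, f.hjk.symm]
theorem chart_rollE (y : ℝ) : f.rollE.chart 0 y = f.chart 1 y := by
  apply f.ext_coord <;>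
    simp [chart, rollE, val_not, f.hij.symm, f.hik, f.hik.symm, f.hjk, f.hjk.symm, f.hij]
theorem chart_rollN (x : ℝ) : f.rollN.chart x 0 = f.chart x 1 := by
  apply f.ext_coord <;>
    simp [chart, rollN, val_not, f.hij.symm, f.hik, f.hik.symm, f.hjk, f.hjk.symm, f.hij]
theorem lin_rollE_flipX (a b : ℝ) : f.rollE.flipX.rollE.lin (-a) b = f.lin a b := by
  apply f.ext_coord <;>
    simp [lin, rollE, flipX, sg_not, f.hij.symm, f.hik, f.hik.symm, f.hjk, f.hjk.symm, f.hij]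

end Frame

/-! ### Crossing an edge and running straight through a square. -/

theorem Tang.sg_nonneg {p w : E3} (h : Tang p w) {l : Fin 3} {b : Bool} (hl : p l = val b 0) :
    0 ≤ sg b * w l := by
  cases b
  · simpa [sg] using h.1 l (by simpa [val] using hl)
  · simpa [sg] using h.2.1 l (by simpa [val] using hl)

section local_lemmas
variable {G : ℝ → E3} {f : Frame} {t x y a b : ℝ}

theorem Good.straight (hG : Good G) (h0 : G t = f.chart x y) (hv : ¬ IsVertex (f.chart x y))
    (hb : HasBackwardDir G t (-f.lin a b)) (hx : x = 0 ∨ x = 1 → a = 0)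
    (hy : y = 0 ∨ y = 1 → b = 0) : HasForwardDir G t (f.lin a b) := by
  obtain ⟨u, w, hu, hw, tu, ⟨-, -, l, hl, hl0⟩, hF⟩ := hG.2 t
  obtain rfl := hu.unique hb
  rw [h0] at hl hF
  suffices w = f.lin a b by rwa [← this]
  rw [f.isVertex_chart] at hv
  by_cases hx' : x = 0 ∨ x = 1
  · have hy' : ¬ (y = 0 ∨ y = 1) := fun h => hv ⟨hx', h⟩
    obtain ⟨e1, e2⟩ := (hF f.i f.k f.j f.hik f.hij f.hjk.symm).1 (f.onWall_i.2 hx') f.onWall_k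
      (fun h => hy' (f.onWall_j.1 h))
    have ha := hx hx'
    subst ha
    simp only [PiLp.neg_apply, Frame.lin_i, Frame.lin_k, Frame.lin_j, mul_zero, neg_zero, abs_zero,
      sub_zero, neg_neg] at e1 e2
    have : w f.i = 0 ∧ w f.k = 0 := by
      rcases f.cover l with rfl | rfl | rfl
      · rw [hl0] at e2; simp at e2; exact ⟨hl0, e2⟩
      · exact absurd (f.onWall_j.1 hl) hy'
      · rw [hl0] at e2; simp at e2; exact ⟨e2, hl0⟩
    apply f.ext_coord <;> simp [*]
  by_cases hy' : y = 0 ∨ y = 1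
  · obtain ⟨e1, e2⟩ := (hF f.j f.k f.i f.hjk f.hij.symm f.hik.symm).1 (f.onWall_j.2 hy') f.onWall_k
      (fun h => hx' (f.onWall_i.1 h))
    have ha := hy hy'
    subst ha
    simp only [PiLp.neg_apply, Frame.lin_i, Frame.lin_k, Frame.lin_j, mul_zero, neg_zero, abs_zero,
      sub_zero, neg_neg] at e1 e2
    have : w f.j = 0 ∧ w f.k = 0 := by
      rcases f.cover l with rfl | rfl | rfl
      · exact absurd (f.onWall_i.1 hl) hx'
      · rw [hl0] at e2; simp at e2; exact ⟨hl0, e2⟩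
      · rw [hl0] at e2; simp at e2; exact ⟨e2, hl0⟩
    apply f.ext_coord <;> simp [*]
  · obtain ⟨e1, e2⟩ := (hF f.k f.i f.j f.hik.symm f.hjk.symm f.hij).2.1 f.onWall_k
      (fun h => hx' (f.onWall_i.1 h)) (fun h => hy' (f.onWall_j.1 h))
    have : w f.k = 0 := by
      rcases f.cover l with rfl | rfl | rfl
      · exact absurd (f.onWall_i.1 hl) hx'
      · exact absurd (f.onWall_j.1 hl) hy'
      · exact hl0
    apply f.ext_coord <;> simp [*]

/-- On an edge, two directions in the same face can be opposite in the unfolding only if both run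
along the edge: the absolute values of the transverse components add up to zero. -/
theorem Good.eq_of_same_face (hG : Good G) {a' b' : ℝ} (h0 : G t = f.chart x y)
    (hv : ¬ IsVertex (f.chart x y)) (hb : HasBackwardDir G t (-f.lin a b))
    (hf : HasForwardDir G t (f.lin a' b')) : a' = a ∧ b' = b := by
  obtain ⟨u, w, hu, hw, -, -, hF⟩ := hG.2 t
  obtain rfl := hu.unique hb
  obtain rfl := hw.unique hf
  rw [h0] at hF
  rw [f.isVertex_chart] at hv
  by_cases hx' : x = 0 ∨ x = 1
  · have hy' : ¬ (y = 0 ∨ y = 1) := fun h => hv ⟨hx', h⟩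
    obtain ⟨e1, e2⟩ := (hF f.i f.k f.j f.hik f.hij f.hjk.symm).1 (f.onWall_i.2 hx') f.onWall_k
      (fun h => hy' (f.onWall_j.1 h))
    simp [abs_mul, abs_sg, sg_ne_zero] at e1 e2
    have h1 := abs_nonneg a
    have h2 := abs_nonneg a'
    exact ⟨by rw [abs_eq_zero.1 (show |a'| = 0 by linarith), abs_eq_zero.1 (show |a| = 0 by linarith)],
      e1⟩
  by_cases hy' : y = 0 ∨ y = 1
  · obtain ⟨e1, e2⟩ := (hF f.j f.k f.i f.hjk f.hij.symm f.hik.symm).1 (f.onWall_j.2 hy') f.onWall_k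
      (fun h => hx' (f.onWall_i.1 h))
    simp [abs_mul, abs_sg, sg_ne_zero] at e1 e2
    have h1 := abs_nonneg b
    have h2 := abs_nonneg b'
    exact ⟨e1,
      by rw [abs_eq_zero.1 (show |b'| = 0 by linarith), abs_eq_zero.1 (show |b| = 0 by linarith)]⟩
  · obtain ⟨e1, e2⟩ := (hF f.k f.i f.j f.hik.symm f.hjk.symm f.hij).2.1 f.onWall_k
      (fun h => hx' (f.onWall_i.1 h)) (fun h => hy' (f.onWall_j.1 h))
    simp [sg_ne_zero] at e1 e2
    exact ⟨e1, e2⟩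

theorem Good.crossE (hG : Good G) (h0 : G t = f.chart 1 y) (hy : y ∈ Ioo (0 : ℝ) 1)
    (hb : HasBackwardDir G t (-f.lin a b)) (ha : 0 < a) : HasForwardDir G t (f.rollE.lin a b) := by
  obtain ⟨u, w, hu, hw, tu, tw, hF⟩ := hG.2 t
  obtain rfl := hu.unique hb
  rw [h0] at tw hF
  suffices w = f.rollE.lin a b by rwa [← this]
  have hy' : ¬ (y = 0 ∨ y = 1) := by rintro (h | h) <;> [exact hy.1.ne' h; exact hy.2.ne h]
  obtain ⟨e1, e2⟩ := (hF f.i f.k f.j f.hik f.hij f.hjk.symm).1 (f.onWall_i.2 (Or.inr rfl)) f.onWall_k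
    (fun h => hy' (f.onWall_j.1 h))
  simp [abs_mul, abs_sg, abs_of_pos ha] at e1 e2
  have hs := tw.sg_nonneg (f.chart_k 1 y)
  obtain ⟨-, -, l, hl, hl0⟩ := tw
  have : w f.i = 0 := by
    rcases f.cover l with rfl | rfl | rfl
    · exact hl0
    · exact absurd (f.onWall_j.1 hl) hy'
    · rw [hl0] at e2; have := abs_nonneg (w f.i); simp at e2; linarith
  have hk : w f.k = sg f.bk * a := by
    rw [this] at e2
    simp at e2
    cases hb : f.bk <;> simp [hb, sg] at hs ⊢
    · rw [← e2, abs_of_nonneg hs]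
    · rw [← e2, abs_of_nonpos hs, neg_neg]
  apply f.ext_coord
  · rw [this]; exact (f.rollE.lin_k a b).symm
  · rw [e1]; exact (f.rollE.lin_j a b).symm
  · rw [hk]; exact (f.rollE.lin_i a b).symm

theorem Good.crossN (hG : Good G) (h0 : G t = f.chart x 1) (hx : x ∈ Ioo (0 : ℝ) 1)
    (hb : HasBackwardDir G t (-f.lin a b)) (ha : 0 < b) : HasForwardDir G t (f.rollN.lin a b) := by
  have := hG.crossE (f := f.swap) (by rw [h0, Frame.chart_swap]) hx
    (by rw [Frame.lin_swap]; exact hb) ha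
  rwa [← Frame.lin_swap] at this

/-- Reflection makes the west edge of the rolled square an east edge, and rolling across it gives
`f` again, up to the same reflection. -/
theorem Good.crossW (hG : Good G) (h0 : G t = f.rollE.chart 0 y) (hy : y ∈ Ioo (0 : ℝ) 1)
    (hb : HasBackwardDir G t (-f.rollE.lin a b)) (ha : a < 0) : HasForwardDir G t (f.lin a b) := by
  have := hG.crossE (f := f.rollE.flipX) (a := -a) (b := b)
    (by rw [h0, Frame.chart_flipX, sub_self]) hy
    (by rw [Frame.lin_flipX, neg_neg]; exact hb) (neg_pos.2 ha)
  rwa [Frame.lin_rollE_flipX] at this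

theorem Good.crossS (hG : Good G) (h0 : G t = f.rollN.chart x 0) (hx : x ∈ Ioo (0 : ℝ) 1)
    (hb : HasBackwardDir G t (-f.rollN.lin a b)) (ha : b < 0) : HasForwardDir G t (f.lin a b) := by
  have e : f.rollN.swap = f.swap.rollE := rfl
  have := hG.crossW (f := f.swap) (by rw [h0, ← e, Frame.chart_swap]) hx
    (by rw [← e, Frame.lin_swap]; exact hb) ha
  rwa [Frame.lin_swap] at this

/-- Over `[r₀, r₁]` the curve runs straight in the plane of the square `f`. -/
def Runs (G : ℝ → E3) (f : Frame) (t x y a b r₀ r₁ : ℝ) : Prop :=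
  ∀ s ∈ Icc r₀ r₁, G (t + s) = f.chart (x + s * a) (y + s * b)

variable {r₀ r₁ r : ℝ}

theorem Runs.forward (h : Runs G f t x y a b r₀ r₁) (hn : a ^ 2 + b ^ 2 = 1) (h0 : r₀ ≤ r)
    (h1 : r < r₁) : HasForwardDir G (t + r) (f.lin a b) := by
  refine ⟨f.norm_lin.2 hn, r₁ - r, sub_pos.2 h1, fun s hs => ?_⟩
  rw [h r ⟨h0, h1.le⟩, add_assoc, h (r + s) ⟨by linarith [hs.1], by linarith [hs.2]⟩,
    ← f.chart_add]
  congr 1 <;> ring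

theorem Runs.backward (h : Runs G f t x y a b r₀ r₁) (hn : a ^ 2 + b ^ 2 = 1) (h0 : r₀ < r)
    (h1 : r ≤ r₁) : HasBackwardDir G (t + r) (-f.lin a b) := by
  refine ⟨by rw [norm_neg]; exact f.norm_lin.2 hn, r - r₀, sub_pos.2 h0, fun s hs => ?_⟩
  rw [h r ⟨h0.le, h1⟩, add_sub_assoc, h (r - s) ⟨by linarith [hs.2], by linarith [hs.1]⟩,
    ← f.lin_neg, ← f.chart_add]
  congr 1 <;> ring

theorem continuous_chart : Continuous fun s => f.chart (x + s * a) (y + s * b) := by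
  simp only [f.chart_add]; fun_prop

/-- A curve that enters a closed square straight runs straight through it. -/
theorem Good.travel (hG : Good G) {S : ℝ} (h0 : G t = f.chart x y)
    (hf : HasForwardDir G t (f.lin a b)) (hx : x ∈ Icc (0 : ℝ) 1) (hy : y ∈ Icc (0 : ℝ) 1)
    (hx' : x + S * a ∈ Icc (0 : ℝ) 1) (hy' : y + S * b ∈ Icc (0 : ℝ) 1)
    (hv : ∀ s ∈ Ioo 0 S, ¬ IsVertex (f.chart (x + s * a) (y + s * b))) :
    Runs G f t x y a b 0 S := by
  rcases le_or_gt S 0 with hS | hS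
  · intro s hs
    obtain rfl : s = 0 := le_antisymm (hs.2.trans hS) hs.1
    simpa using h0
  have hn := f.norm_lin.1 hf.1
  have hcont := hG.continuous
  -- Continuous induction on the length of the straight run. The minimum makes the condition
  -- meaningful for every real r and exhibits the set as an intersection of closed sets.
  set A : Set ℝ := {r | ∀ r' ∈ Icc 0 S, G (t + min r r') = f.chart (x + min r r' * a) (y + min r r' * b)}
    with hA
  have hcl : IsClosed A := by
    have : A = ⋂ r' ∈ Icc 0 S, {r | G (t + min r r') = f.chart (x + min r r' * a) (y + min r r' * b)} := by
      ext; simp [hA]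
    rw [this]
    refine isClosed_biInter fun r' _ => isClosed_eq (by fun_prop) ?_
    exact (continuous_chart (f := f)).comp (by fun_prop : Continuous fun r => min r r')
  have hAr : ∀ r, 0 ≤ r → r ≤ S → (r ∈ A ↔ Runs G f t x y a b 0 r) := by
    intro r hr0 hrS
    constructor
    · intro h s hs
      have := h s ⟨hs.1, hs.2.trans hrS⟩
      rwa [min_eq_right hs.2] at this
    · intro h s hs
      exact h _ ⟨le_min hr0 hs.1, min_le_left _ _⟩
  have hzero : (0 : ℝ) ∈ A := by
    rw [hAr 0 le_rfl hS.le]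
    intro s hs
    obtain rfl : s = 0 := le_antisymm hs.2 hs.1
    simpa using h0
  have key : Icc 0 S ⊆ A := by
    refine IsClosed.Icc_subset_of_forall_exists_gt (hcl.inter isClosed_Icc) hzero ?_
    rintro r ⟨hr, hr0, hrS⟩ z hz
    have hrun := (hAr r hr0 hrS.le).1 hr
    have hfor : HasForwardDir G (t + r) (f.lin a b) := by
      rcases eq_or_lt_of_le hr0 with rfl | hr0'
      · simpa using hf
      · refine hG.straight (hrun r ⟨hr0, le_rfl⟩) (hv r ⟨hr0', hrS⟩)
          (hrun.backward hn hr0' le_rfl) ?_ ?_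
        -- An affine function with both end values in [0, 1] that takes the value 0 or 1 strictly in
        -- between is constant.
        · rintro (h | h)
          · have h1 : a * S = a * r * (S / r) := by field_simp
            have h2 := hx.1; have h3 := hx'.1
            have h4 : 0 < S - r := by linarith
            have : x = 0 := by nlinarith
            subst this
            have : r * a = 0 := by linarith
            rcases mul_eq_zero.1 this with h | h <;> [exact absurd h hr0'.ne'; exact h]
          · have h2 := hx.2; have h3 := hx'.2
            have h4 : 0 < S - r := by linarith
            have : x = 1 := by nlinarith
            subst this
            have : r * a = 0 := by linarith
            rcases mul_eq_zero.1 this with h | h <;> [exact absurd h hr0'.ne'; exact h]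
        · rintro (h | h)
          · have h2 := hy.1; have h3 := hy'.1
            have h4 : 0 < S - r := by linarith
            have : y = 0 := by nlinarith
            subst this
            have : r * b = 0 := by linarith
            rcases mul_eq_zero.1 this with h | h <;> [exact absurd h hr0'.ne'; exact h]
          · have h2 := hy.2; have h3 := hy'.2
            have h4 : 0 < S - r := by linarith
            have : y = 1 := by nlinarith
            subst this
            have : r * b = 0 := by linarith
            rcases mul_eq_zero.1 this with h | h <;> [exact absurd h hr0'.ne'; exact h]
    obtain ⟨-, ε, hε, h⟩ := hfor
    have hz : r < z := hz
    refine ⟨min (r + ε) (min z S), ?_, ?_, (min_le_right _ _).trans (min_le_left _ _)⟩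
    · rw [hAr _ (le_min (by linarith) (le_min (by linarith) hS.le))
        ((min_le_right _ _).trans (min_le_right _ _))]
      intro s hs
      rcases le_total s r with hsr | hsr
      · exact hrun s ⟨hs.1, hsr⟩
      · have h1 := hs.2.trans (min_le_left _ _)
        have h2 := h (s - r) ⟨by linarith, by linarith⟩
        rw [hrun r ⟨hr0, le_rfl⟩, ← f.chart_add] at h2
        convert h2 using 2 <;> ring
    · exact lt_min (by linarith) (lt_min hz hrS)
  exact (hAr S hS.le le_rfl).1 (key ⟨hS.le, le_rfl⟩)

end local_lemmas

/-! ### Development of the segment into the lattice, and the record of faces met. -/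

/-- The curve `γ` enters, at the parameter `a + r`, the square `f` of the unit lattice with lower left
corner `(p, q)`; there it unfolds to the ray from the origin in the direction `(A, B)`. -/
structure Stage (γ : ℝ → E3) (a A B : ℝ) (f : Frame) (p q r : ℝ) : Prop where
  pos : γ (a + r) = f.chart (-p + r * A) (-q + r * B)
  dir : HasForwardDir γ (a + r) (f.lin A B)
  left : p ≤ r * A
  right : r * A < p + 1
  bot : q ≤ r * B
  top : r * B < q + 1

/-- Over `[r, r']` the curve `γ` unfolds, in the square `f` with lower left corner `(p, q)`, to the
ray from the origin in the direction `(A, B)`. -/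
abbrev Rep (γ : ℝ → E3) (a A B : ℝ) (f : Frame) (p q r r' : ℝ) : Prop :=
  Runs γ f a (-p) (-q) A B r r'

/-- The faces that `γ` runs through up to the parameter `a + R`, each of them only once. -/
structure Trace (γ : ℝ → E3) (a R : ℝ) (S : List (Fin 3 × Bool)) : Prop where
  mem : ∀ r ∈ Icc 0 R, ∀ i c, γ (a + r) ∈ openFace i c → (i, c) ∈ S
  conn : ∀ r ∈ Icc 0 R, ∀ r' ∈ Icc 0 R, ∀ i c, γ (a + r) ∈ openFace i c →
    γ (a + r') ∈ openFace i c → ∀ z ∈ Icc r r', γ (a + z) ∈ openFace i c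
  vertex : ∀ r ∈ Ioo 0 R, ¬ IsVertex (γ (a + r))

section
variable {γ : ℝ → E3} {a A B : ℝ} {f : Frame} {p q r r' : ℝ} {S : List (Fin 3 × Bool)}

theorem not_mem_openFace_of_edge {x y : ℝ} (hx : x ∈ Icc (0 : ℝ) 1) (hy : y ∈ Icc (0 : ℝ) 1)
    (h : x = 0 ∨ x = 1 ∨ y = 0 ∨ y = 1) (i : Fin 3) (c : Bool) : f.chart x y ∉ openFace i c := by
  rw [f.mem_openFace hx hy]
  rintro ⟨-, -, h1, h2⟩
  rcases h with h | h | h | h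
  · exact h1.1.ne' h
  · exact h1.2.ne h
  · exact h2.1.ne' h
  · exact h2.2.ne h

theorem Stage.runs (hG : Good γ) (hA : 0 < A) (hB : 0 < B) (h : Stage γ a A B f p q r)
    (hr : r ≤ r') (h1 : r' * A ≤ p + 1) (h2 : r' * B ≤ q + 1) :
    Rep γ a A B f p q r r' := by
  have hl := h.left; have hb := h.bot
  have e1 : r * A ≤ r' * A := by gcongr
  have e2 : r * B ≤ r' * B := by gcongr
  have := hG.travel (S := r' - r) h.pos h.dir ⟨by linarith, by linarith [h.right]⟩
    ⟨by linarith, by linarith [h.top]⟩ ⟨by linarith, by linarith⟩ ⟨by linarith, by linarith⟩ ?_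
  · intro s hs
    have h3 := this (s - r) ⟨by linarith [hs.1], by linarith [hs.2]⟩
    convert h3 using 2 <;> ring
  · intro s hs
    rw [f.isVertex_chart]
    rintro ⟨h3 | h3, -⟩
    · nlinarith [hs.1]
    · nlinarith [hs.2]

theorem Stage.east (hG : Good γ) (hA : 0 < A) (hB : 0 < B) (hn : A ^ 2 + B ^ 2 = 1)
    (h : Stage γ a A B f p q r) {p' : ℝ} (hp : p + 1 = p') (h1 : p' * B < (q + 1) * A) :
    Rep γ a A B f p q r (p' / A) ∧ r < p' / A ∧ Stage γ a A B f.rollE p' q (p' / A) := by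
  subst hp
  have hr : r < (p + 1) / A := by rw [lt_div_iff₀ hA]; exact h.right
  have e1 : (p + 1) / A * A = p + 1 := by field_simp
  have e2 : (p + 1) / A * B < q + 1 := by
    rw [div_mul_eq_mul_div, div_lt_iff₀ hA]; exact h1
  have e3 : r * B < (p + 1) / A * B := by gcongr
  have hR := h.runs hG hA hB hr.le e1.le e2.le
  have e0 : -p + (p + 1) / A * A = 1 := by rw [e1]; ring
  have hpos := hR _ ⟨hr.le, le_rfl⟩
  rw [e0] at hpos
  have hbot := h.bot
  refine ⟨hR, hr, ⟨?_, ?_, by rw [e1], by rw [e1]; linarith, by linarith, e2⟩⟩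
  · rw [hpos, ← f.chart_rollE, e1]; ring_nf
  · exact hG.crossE hpos ⟨by linarith, by linarith⟩ (hR.backward hn hr le_rfl) hA

theorem Stage.north (hG : Good γ) (hA : 0 < A) (hB : 0 < B) (hn : A ^ 2 + B ^ 2 = 1)
    (h : Stage γ a A B f p q r) {q' : ℝ} (hq : q + 1 = q') (h1 : q' * A < (p + 1) * B) :
    Rep γ a A B f p q r (q' / B) ∧ r < q' / B ∧ Stage γ a A B f.rollN p q' (q' / B) := by
  subst hq
  have hr : r < (q + 1) / B := by rw [lt_div_iff₀ hB]; exact h.top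
  have e1 : (q + 1) / B * B = q + 1 := by field_simp
  have e2 : (q + 1) / B * A < p + 1 := by
    rw [div_mul_eq_mul_div, div_lt_iff₀ hB]; exact h1
  have e3 : r * A < (q + 1) / B * A := by gcongr
  have hR := h.runs hG hA hB hr.le e2.le e1.le
  have e0 : -q + (q + 1) / B * B = 1 := by rw [e1]; ring
  have hpos := hR _ ⟨hr.le, le_rfl⟩
  rw [e0] at hpos
  have hbot := h.left
  refine ⟨hR, hr, ⟨?_, ?_, by linarith, e2, by rw [e1], by rw [e1]; linarith⟩⟩
  · rw [hpos, ← f.chart_rollN, e1]; ring_nf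
  · exact hG.crossN hpos ⟨by linarith, by linarith⟩ (hR.backward hn hr le_rfl) hB

theorem Stage.corner (hG : Good γ) (hA : 0 < A) (hB : 0 < B)
    (h : Stage γ a A B f p q r) (h1 : (p + 1) * B = (q + 1) * A) :
    Rep γ a A B f p q r ((p + 1) / A) ∧ r < (p + 1) / A ∧
      IsVertex (γ (a + (p + 1) / A)) := by
  have hr : r < (p + 1) / A := by rw [lt_div_iff₀ hA]; exact h.right
  have e1 : (p + 1) / A * A = p + 1 := by field_simp
  have e2 : (p + 1) / A * B = q + 1 := by
    rw [div_mul_eq_mul_div, div_eq_iff hA.ne']; exact h1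
  have hR := h.runs hG hA hB hr.le e1.le e2.le
  refine ⟨hR, hr, ?_⟩
  rw [hR _ ⟨hr.le, le_rfl⟩, f.isVertex_chart, e1, e2]
  constructor <;> right <;> ring

/-- The open square is traversed during a single interval whose ends lie on edges. Its face is new,
so no face acquires a second crossing. -/
theorem Trace.cons (hA : 0 < A) (hB : 0 < B) (hT : Trace γ a r S) (h0 : 0 ≤ r)
    (h : Stage γ a A B f p q r) (hR : Rep γ a A B f p q r r') (hr : r < r')
    (hS : (f.k, f.bk) ∉ S) (hv : r = 0 ∨ ¬ IsVertex (γ (a + r)))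
    (hx : r' * A ≤ p + 1) (hy : r' * B ≤ q + 1) (he : r' * A = p + 1 ∨ r' * B = q + 1) :
    Trace γ a r' ((f.k, f.bk) :: S) := by
  have hl := h.left; have hb := h.bot
  have hin : ∀ z ∈ Ioo r r', -p + z * A ∈ Ioo (0 : ℝ) 1 ∧ -q + z * B ∈ Ioo (0 : ℝ) 1 := by
    intro z hz
    have e1 : r * A < z * A := by have := hz.1; gcongr
    have e2 : r * B < z * B := by have := hz.1; gcongr
    have e3 : z * A < r' * A := by have := hz.2; gcongr
    have e4 : z * B < r' * B := by have := hz.2; gcongr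
    refine ⟨⟨?_, ?_⟩, ?_, ?_⟩ <;> linarith
  have hface : ∀ z ∈ Ioo r r', ∀ i c, γ (a + z) ∈ openFace i c ↔ i = f.k ∧ c = f.bk := by
    intro z hz i c
    have := hin z hz
    rw [hR z ⟨hz.1.le, hz.2.le⟩, f.mem_openFace (Ioo_subset_Icc_self this.1)
      (Ioo_subset_Icc_self this.2)]
    tauto
  have hlast : ∀ i c, γ (a + r') ∉ openFace i c := by
    have e1 : r * A < r' * A := by gcongr
    have e2 : r * B < r' * B := by gcongr
    rw [hR r' ⟨hr.le, le_rfl⟩]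
    refine not_mem_openFace_of_edge ⟨by linarith, by linarith⟩ ⟨by linarith, by linarith⟩ ?_
    rcases he with h | h
    · right; left; linarith
    · right; right; right; linarith
  have hsplit : ∀ z ∈ Icc 0 r', ∀ i c, γ (a + z) ∈ openFace i c → z ∈ Icc 0 r ∨ z ∈ Ioo r r' := by
    intro z hz i c hzf
    rcases le_or_gt z r with h | h
    · exact Or.inl ⟨hz.1, h⟩
    · refine Or.inr ⟨h, lt_of_le_of_ne hz.2 ?_⟩
      rintro rfl
      exact hlast i c hzf
  refine ⟨fun z hz i c hzf => ?_, fun z hz z' hz' i c h1 h2 y hy => ?_, fun z hz => ?_⟩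
  · rcases hsplit z hz i c hzf with h | h
    · exact List.mem_cons_of_mem _ (hT.mem z h i c hzf)
    · obtain ⟨rfl, rfl⟩ := (hface z h i c).1 hzf
      exact List.mem_cons_self
  · rcases hsplit z hz i c h1 with h | h <;> rcases hsplit z' hz' i c h2 with h' | h'
    · exact hT.conn z h z' h' i c h1 h2 y hy
    · obtain ⟨rfl, rfl⟩ := (hface z' h' i c).1 h2
      exact absurd (hT.mem z h _ _ h1) hS
    · obtain ⟨rfl, rfl⟩ := (hface z h i c).1 h1
      exact absurd (hT.mem z' h' _ _ h2) hS
    · exact (hface y ⟨h.1.trans_le hy.1, hy.2.trans_lt h'.2⟩ i c).2 ((hface z h i c).1 h1)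
  · rcases lt_trichotomy z r with h | h | h
    · exact hT.vertex z ⟨hz.1, h⟩
    · subst h
      exact hv.resolve_left hz.1.ne'
    · have := hin z ⟨h, hz.2⟩
      rw [hR z ⟨h.le, hz.2.le⟩, f.isVertex_chart]
      rintro ⟨h3 | h3, -⟩
      · exact this.1.1.ne' h3
      · exact this.1.2.ne h3

theorem Trace.crossings_le_one {b R : ℝ} (hab : IsGeodesicSegment γ a b) (hT : Trace γ a R S)
    (hR : 0 < R) (hv : IsVertex (γ (a + R))) (i : Fin 3) (c : Bool) :
    (faceCrossings γ a b i c).encard ≤ 1 := by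
  have hlt := hab.lt
  have hb : b = a + R := by
    rcases lt_trichotomy b (a + R) with h | h | h
    · refine absurd ?_ (hT.vertex (b - a) ⟨by linarith, by linarith⟩)
      rw [add_sub_cancel]; exact hab.end_vertex
    · exact h
    -- A geodesic through a vertex would need the total angle 2π, but there is only 3π/2.
    · obtain ⟨u, w, -, -, h1, h2⟩ := hab.geodesic (a + R) ⟨by linarith, h⟩
      rw [otherSideAngle, h1, totalAngle, if_pos hv] at h2
      have := Real.pi_pos
      linarith
  subst hb
  have key : ∀ t ∈ Icc a (a + R) ∩ γ ⁻¹' openFace i c, ∀ t' ∈ Icc a (a + R) ∩ γ ⁻¹' openFace i c,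
      t ≤ t' → connectedComponentIn (Icc a (a + R) ∩ γ ⁻¹' openFace i c) t =
        connectedComponentIn (Icc a (a + R) ∩ γ ⁻¹' openFace i c) t' := by
    rintro t ⟨⟨h1, h2⟩, h3⟩ t' ⟨⟨h4, h5⟩, h6⟩ hle
    have hsub : Icc t t' ⊆ Icc a (a + R) ∩ γ ⁻¹' openFace i c := by
      intro z hz
      refine ⟨⟨h1.trans hz.1, hz.2.trans h5⟩, ?_⟩
      have := hT.conn (t - a) ⟨by linarith, by linarith⟩ (t' - a) ⟨by linarith, by linarith⟩ i c
        (by rwa [add_sub_cancel]) (by rwa [add_sub_cancel]) (z - a)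
        ⟨by linarith [hz.1], by linarith [hz.2]⟩
      rwa [add_sub_cancel] at this
    exact connectedComponentIn_eq
      (isPreconnected_Icc.subset_connectedComponentIn (left_mem_Icc.2 hle) hsub
        (right_mem_Icc.2 hle))
  rw [encard_le_one_iff]
  rintro I J ⟨t, ht, rfl⟩ ⟨t', ht', rfl⟩
  rcases le_total t t' with h | h
  · exact key t ht t' ht' h
  · exact (key t' ht' t ht h).symm

/-- The tree of unfoldings: a stage, with the faces met so far. -/
def Node (γ : ℝ → E3) (a A B : ℝ) (f : Frame) (p q r : ℝ) (S : List (Fin 3 × Bool)) : Prop :=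
  Stage γ a A B f p q r ∧ Trace γ a r S ∧ (r = 0 ∨ 0 < r ∧ ¬ IsVertex (γ (a + r)))

theorem Stage.not_vertex (h : Stage γ a A B f p q r) (h' : p < r * A ∨ q < r * B) :
    ¬ IsVertex (γ (a + r)) := by
  have h1 := h.right; have h2 := h.top
  rw [h.pos, f.isVertex_chart]
  rintro ⟨h3 | h3, h4 | h4⟩ <;> rcases h' with h' | h' <;> linarith

theorem Node.nonneg (h : Node γ a A B f p q r S) : 0 ≤ r := by
  rcases h.2.2 with h | h
  · exact h.ge
  · exact h.1.le

theorem Node.east (hG : Good γ) (hA : 0 < A) (hB : 0 < B) (hn : A ^ 2 + B ^ 2 = 1)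
    (h : Node γ a A B f p q r S) {p' : ℝ} (hp : p + 1 = p') (h1 : p' * B < (q + 1) * A)
    (hS : (f.k, f.bk) ∉ S) :
    Rep γ a A B f p q r (p' / A) ∧ Node γ a A B f.rollE p' q (p' / A) ((f.k, f.bk) :: S) := by
  subst hp
  obtain ⟨hR, hr, hst⟩ := h.1.east hG hA hB hn rfl h1
  refine ⟨hR, hst, h.2.1.cons hA hB h.nonneg h.1 hR hr hS (h.2.2.imp id And.right)
    (by field_simp; exact le_rfl) hst.top.le (Or.inl (by field_simp)),
    Or.inr ⟨h.nonneg.trans_lt hr, hst.not_vertex (Or.inr (h.1.bot.trans_lt (by gcongr)))⟩⟩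

theorem Node.north (hG : Good γ) (hA : 0 < A) (hB : 0 < B) (hn : A ^ 2 + B ^ 2 = 1)
    (h : Node γ a A B f p q r S) {q' : ℝ} (hq : q + 1 = q') (h1 : q' * A < (p + 1) * B)
    (hS : (f.k, f.bk) ∉ S) :
    Rep γ a A B f p q r (q' / B) ∧ Node γ a A B f.rollN p q' (q' / B) ((f.k, f.bk) :: S) := by
  subst hq
  obtain ⟨hR, hr, hst⟩ := h.1.north hG hA hB hn rfl h1
  refine ⟨hR, hst, h.2.1.cons hA hB h.nonneg h.1 hR hr hS (h.2.2.imp id And.right)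
    hst.right.le (by field_simp; exact le_rfl) (Or.inr (by field_simp)),
    Or.inr ⟨h.nonneg.trans_lt hr, hst.not_vertex (Or.inl (h.1.left.trans_lt (by gcongr)))⟩⟩

theorem Node.corner {b : ℝ} (hG : Good γ) (hA : 0 < A) (hB : 0 < B)
    (hab : IsGeodesicSegment γ a b)
    (h : Node γ a A B f p q r S) (h1 : (p + 1) * B = (q + 1) * A) (hS : (f.k, f.bk) ∉ S)
    (i : Fin 3) (c : Bool) : (faceCrossings γ a b i c).encard ≤ 1 := by
  obtain ⟨hR, hr, hv⟩ := h.1.corner hG hA hB h1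
  exact (h.2.1.cons hA hB h.nonneg h.1 hR hr hS (h.2.2.imp id And.right)
    (by field_simp; exact le_rfl) (by rw [div_mul_eq_mul_div, div_le_iff₀ hA]; exact h1.le)
    (Or.inl (by field_simp))).crossings_le_one hab (h.nonneg.trans_lt hr) hv i c

theorem Node.start (h0 : γ a = f.chart 0 0) (hf : HasForwardDir γ a (f.lin A B)) :
    Node γ a A B f 0 0 0 [] := by
  have hz : ∀ i c, γ (a + 0) ∉ openFace i c := by
    rw [add_zero, h0]
    exact not_mem_openFace_of_edge (by simp) (by simp) (Or.inl rfl)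
  refine ⟨⟨by simpa using h0, by simpa using hf, by simp, by simp, by simp, by simp⟩,
    ⟨fun r hr i c h => ?_, fun r hr r' hr' i c h => ?_, fun r hr => ?_⟩, Or.inl rfl⟩
  · obtain rfl : r = 0 := le_antisymm hr.2 hr.1
    exact absurd h (hz i c)
  · obtain rfl : r = 0 := le_antisymm hr.2 hr.1
    exact absurd h (hz i c)
  · exact absurd (hr.1.trans hr.2) (lt_irrefl _)

end

/-! ### Rays of the reversed curve, and their turns at corners. -/

namespace Frame
variable (f : Frame)

theorem lin_rollE_rot (c d : ℝ) : f.rollE.rot.lin c d = f.lin (-d) c := by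
  apply f.ext_coord <;>
    simp [lin, rollE, rot, sg_not, f.hij, f.hij.symm, f.hik, f.hik.symm, f.hjk, f.hjk.symm]

theorem lin_rollE_rot_rot (c : ℝ) : f.rollE.rot.rot.lin c 0 = f.lin (-c) 0 := by
  apply f.ext_coord <;>
    simp [lin, rollE, rot, sg_not, f.hij, f.hij.symm, f.hik, f.hik.symm, f.hjk, f.hjk.symm]

/-- Around a lattice point the upper right, upper left and lower left squares are the three faces at
the vertex. The lower right square is the missing quarter turn. -/
theorem lin_rollN_rollE_rot_rot (c d : ℝ) : f.rollN.rollE.rot.rot.lin c d = f.lin (-c) (-d) := by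
  apply f.ext_coord <;>
    simp [lin, rollE, rollN, rot, sg_not, f.hij, f.hij.symm, f.hik, f.hik.symm, f.hjk, f.hjk.symm]

end Frame

/-- The curve `G` is at the point `(x, y)` of the square `f` and proceeds in the direction
`(dx, dy)`. -/
def RayAt (G : ℝ → E3) (f : Frame) (t x y dx dy : ℝ) : Prop :=
  G t = f.chart x y ∧ HasForwardDir G t (f.lin dx dy)

/-- The curve `G` is at the corner `(0, 0)` of the square `f`, where it arrives straight from the
point in the direction `(c, d)`. -/
def CornerAt (G : ℝ → E3) (f : Frame) (t c d : ℝ) : Prop :=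
  G t = f.chart 0 0 ∧ HasBackwardDir G t (f.lin c d)

section
variable {G : ℝ → E3} {f : Frame} {t x y dx dy x' y' : ℝ}

theorem RayAt.unit (h : RayAt G f t x y dx dy) : dx ^ 2 + dy ^ 2 = 1 := f.norm_lin.1 h.2.1

/-- The equation `e` is the height of the exit point with its denominator cleared. -/
theorem RayAt.runs_left (hG : Good G) (h : RayAt G f t x y dx dy) (hdx : dx < 0)
    (hx : 0 < x) (hx1 : x ≤ 1) (hy : y ∈ Icc (0 : ℝ) 1) (hy' : y' ∈ Icc (0 : ℝ) 1)
    (e : y' * -dx = y * -dx + x * dy) : ∃ s > 0, G (t + s) = f.chart 0 y' ∧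
      HasBackwardDir G (t + s) (-f.lin dx dy) := by
  have hs : 0 < x / -dx := div_pos hx (neg_pos.2 hdx)
  have e1 : x + x / -dx * dx = 0 := by
    have := hdx.ne
    field_simp
    ring
  have e2 : y + x / -dx * dy = y' := by
    have := hdx.ne
    have h3 : (y + x / -dx * dy) * -dx = y' * -dx := by
      rw [e, add_mul, mul_right_comm, div_mul_cancel₀ _ (neg_ne_zero.2 this)]
    exact mul_right_cancel₀ (neg_ne_zero.2 this) h3
  have hR := hG.travel (S := x / -dx) h.1 h.2 ⟨hx.le, hx1⟩ hy (by rw [e1]; simp) (by rwa [e2]) ?_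
  · refine ⟨_, hs, ?_, hR.backward h.unit hs le_rfl⟩
    rw [hR _ ⟨hs.le, le_rfl⟩, e1, e2]
  · intro s hs
    rw [f.isVertex_chart]
    rintro ⟨h3 | h3, -⟩
    · nlinarith [hs.2]
    · nlinarith [hs.1]

theorem RayAt.runs_down (hG : Good G) (h : RayAt G f t x y dx dy) (hdy : dy < 0)
    (hy : 0 < y) (hy1 : y ≤ 1) (hx : x ∈ Icc (0 : ℝ) 1) (hx' : x' ∈ Icc (0 : ℝ) 1)
    (e : x' * -dy = x * -dy + y * dx) : ∃ s > 0, G (t + s) = f.chart x' 0 ∧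
      HasBackwardDir G (t + s) (-f.lin dx dy) := by
  have h' : RayAt G f.swap t y x dy dx := by
    rwa [RayAt, f.chart_swap, f.lin_swap]
  obtain ⟨s, hs, h1, h2⟩ := h'.runs_left hG hdy hy hy1 hx hx' e
  exact ⟨s, hs, by rwa [f.chart_swap] at h1, by rwa [f.lin_swap] at h2⟩

theorem RayAt.runs_up (hG : Good G) (h : RayAt G f t x y dx dy) (hdy : 0 < dy)
    (hy : 0 ≤ y) (hy1 : y < 1) (hx : x ∈ Icc (0 : ℝ) 1) (hx' : x' ∈ Icc (0 : ℝ) 1)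
    (e : x' * dy = x * dy + (1 - y) * dx) : ∃ s > 0, G (t + s) = f.chart x' 1 ∧
      HasBackwardDir G (t + s) (-f.lin dx dy) := by
  have e1 : ∀ x y, f.swap.flipX.chart y x = f.chart x (1 - y) := fun x y => by
    rw [Frame.chart_flipX, Frame.chart_swap]
  have e2 : ∀ x y, f.swap.flipX.lin y x = f.lin x (-y) := fun x y => by
    rw [Frame.lin_flipX, Frame.lin_swap]
  have h' : RayAt G f.swap.flipX t (1 - y) x (-dy) dx := by
    rwa [RayAt, e1, e2, sub_sub_cancel, neg_neg]
  obtain ⟨s, hs, h1, h2⟩ := h'.runs_left hG (neg_neg_of_pos hdy) (by linarith) (by linarith) hx hx'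
    (by rwa [neg_neg])
  exact ⟨s, hs, by rwa [e1, sub_zero] at h1, by rwa [e2, neg_neg] at h2⟩

theorem RayAt.west (hG : Good G) (h : RayAt G f.rollE t x y dx dy) (hdx : dx < 0)
    (hx : 0 < x) (hx1 : x ≤ 1) (hy : y ∈ Icc (0 : ℝ) 1) (hy' : y' ∈ Ioo (0 : ℝ) 1)
    (e : y' * -dx = y * -dx + x * dy) : ∃ t', RayAt G f t' 1 y' dx dy := by
  obtain ⟨s, -, h1, h2⟩ := h.runs_left hG hdx hx hx1 hy (Ioo_subset_Icc_self hy') e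
  exact ⟨t + s, by rw [h1, f.chart_rollE], hG.crossW h1 hy' h2 hdx⟩

theorem RayAt.south (hG : Good G) (h : RayAt G f.rollN t x y dx dy) (hdy : dy < 0)
    (hy : 0 < y) (hy1 : y ≤ 1) (hx : x ∈ Icc (0 : ℝ) 1) (hx' : x' ∈ Ioo (0 : ℝ) 1)
    (e : x' * -dy = x * -dy + y * dx) : ∃ t', RayAt G f t' x' 1 dx dy := by
  obtain ⟨s, -, h1, h2⟩ := h.runs_down hG hdy hy hy1 hx (Ioo_subset_Icc_self hx') e
  exact ⟨t + s, by rw [h1, f.chart_rollN], hG.crossS h1 hx' h2 hdy⟩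

theorem RayAt.north (hG : Good G) (h : RayAt G f t x y dx dy) (hdy : 0 < dy)
    (hy : 0 ≤ y) (hy1 : y < 1) (hx : x ∈ Icc (0 : ℝ) 1) (hx' : x' ∈ Ioo (0 : ℝ) 1)
    (e : x' * dy = x * dy + (1 - y) * dx) : ∃ t', RayAt G f.rollN t' x' 0 dx dy := by
  obtain ⟨s, -, h1, h2⟩ := h.runs_up hG hdy hy hy1 hx (Ioo_subset_Icc_self hx') e
  exact ⟨t + s, by rw [h1, f.chart_rollN], hG.crossN h1 hx' h2 hdy⟩

theorem RayAt.corner (hG : Good G) {c d : ℝ} (h : RayAt G f t x y (-c) (-d)) (hc : 0 < c)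
    (hx : 0 < x) (hx1 : x ≤ 1) (hy : y ∈ Icc (0 : ℝ) 1) (e : y * c = x * d) :
    ∃ t', CornerAt G f t' c d := by
  obtain ⟨s, -, h1, h2⟩ := h.runs_left (y' := 0) hG (neg_neg_of_pos hc) hx hx1 hy (by simp)
    (by linarith)
  exact ⟨t + s, h1, by rwa [f.lin_neg, neg_neg] at h2⟩

/-- A direction at a corner that keeps at least a right angle from `(c, d)` lies in one of the two
faces that do not contain `(c, d)`. -/
theorem CornerAt.next (hG : Good G) {u v : ℝ} (h : CornerAt G f t u v) (hu : 0 < u) (hv : 0 ≤ v) :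
    ∃ c d : ℝ, 0 ≤ c ∧ 0 ≤ d ∧ c ^ 2 + d ^ 2 = 1 ∧ (HasForwardDir G t (f.rot.lin c d) ∨
      HasForwardDir G t (f.rot.rot.lin c d) ∧ u * d ≤ v * c) := by
  obtain ⟨u', w, hu', hw, -, tw, hF⟩ := hG.2 t
  obtain rfl := hu'.unique h.2
  rw [h.1] at tw hF
  have hvx : IsVertex (f.chart 0 0) := f.isVertex_chart.2 (by simp)
  have si := tw.sg_nonneg (f.chart_i 0 0)
  have sj := tw.sg_nonneg (f.chart_j 0 0)
  have sk := tw.sg_nonneg (f.chart_k 0 0)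
  have wi : w f.i = sg f.bi * (sg f.bi * w f.i) := by rw [← mul_assoc, sg_mul_self, one_mul]
  have wj : w f.j = sg f.bj * (sg f.bj * w f.j) := by rw [← mul_assoc, sg_mul_self, one_mul]
  have wk : w f.k = sg f.bk * (sg f.bk * w f.k) := by rw [← mul_assoc, sg_mul_self, one_mul]
  have hn := f.sq_norm w
  rw [hw.1, wi, wj, wk] at hn
  generalize sg f.bi * w f.i = p at *
  generalize sg f.bj * w f.j = q at *
  generalize sg f.bk * w f.k = r at *
  simp only [mul_pow, sq (sg _), sg_mul_self, one_mul] at hn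
  obtain ⟨-, -, l, -, hl⟩ := tw
  rcases f.cover l with rfl | rfl | rfl
  · have hp : p = 0 := by rw [hl] at wi; simpa [sg_ne_zero] using wi.symm
    subst hp
    refine ⟨q, r, sj, sk, by linarith, Or.inl ?_⟩
    have : w = f.rot.lin q r := by
      apply f.ext_coord
      · rw [hl]; exact (f.rot.lin_k q r).symm
      · rw [wj]; exact (f.rot.lin_i q r).symm
      · rw [wk]; exact (f.rot.lin_j q r).symm
    rwa [← this]
  · have hq : q = 0 := by rw [hl] at wj; simpa [sg_ne_zero] using wj.symm
    subst hq
    have h1 := ((hF f.j f.i f.k f.hij.symm f.hjk f.hik).2.2 hvx).1 (by simp) hl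
    rw [wi, wk] at h1
    simp only [Frame.lin_i, Frame.lin_j, abs_mul, abs_sg, one_mul, abs_of_pos hu, abs_of_nonneg hv,
      abs_of_nonneg si, abs_of_nonneg sk] at h1
    refine ⟨r, p, sk, si, by linarith, Or.inr ⟨?_, h1⟩⟩
    have : w = f.rot.rot.lin r p := by
      apply f.ext_coord
      · rw [wi]; exact (f.rot.rot.lin_j r p).symm
      · rw [hl]; exact (f.rot.rot.lin_k r p).symm
      · rw [wk]; exact (f.rot.rot.lin_i r p).symm
    rwa [← this]
  · have hr : r = 0 := by rw [hl] at wk; simpa [sg_ne_zero] using wk.symm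
    subst hr
    have h1 := ((hF f.i f.j f.k f.hij f.hik f.hjk).2.2 hvx).2 (by simp) hl
    rw [wi, wj] at h1
    simp only [Frame.lin_i, Frame.lin_j, abs_mul, abs_sg, one_mul, abs_of_pos hu, abs_of_nonneg hv,
      abs_of_nonneg si, abs_of_nonneg sj] at h1
    -- In the same face both products in the inner product are nonnegative, so the new direction is
    -- the edge shared with `f.rot`.
    have hp : p = 0 := by
      have := mul_nonneg hv sj
      have := mul_nonneg hu.le si
      have : u * p = 0 := by linarith
      simpa [hu.ne'] using this
    subst hp
    refine ⟨q, 0, sj, le_rfl, by linarith, Or.inl ?_⟩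
    have : w = f.rot.lin q 0 := by
      apply f.ext_coord
      · rw [wi, mul_zero]; exact (f.rot.lin_k q 0).symm
      · rw [wj]; exact (f.rot.lin_i q 0).symm
      · rw [hl]; exact ((f.rot.lin_j q 0).trans (mul_zero _)).symm
    rwa [← this]

end

/-! ### The strip between boundary and helix, in which rays are trapped. -/

section
variable {γ : ℝ → E3} {L a A B : ℝ} {f : Frame} {p q r₀ r₁ : ℝ} {βx βy : ℝ}

/-- The end of the passage through a square, at the parameter `r`, is no corner. -/
structure Exit (A B p q r : ℝ) : Prop where
  right : r * A ≤ p + 1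
  top : r * B ≤ q + 1
  strict : r * A < p + 1 ∨ r * B < q + 1

theorem Exit.east (hA : 0 < A) {p' : ℝ} (hp : p + 1 = p') (h : p' * B < (q + 1) * A) :
    Exit A B p q (p' / A) := by
  have h1 : p' / A * A = p' := by field_simp
  have h2 : p' / A * B < q + 1 := by rwa [div_mul_eq_mul_div, div_lt_iff₀ hA]
  exact ⟨by linarith, h2.le, Or.inr h2⟩

theorem Exit.north (hB : 0 < B) {q' : ℝ} (hq : q + 1 = q') (h : q' * A < (p + 1) * B) :
    Exit A B p q (q' / B) := by
  have h1 : q' / B * B = q' := by field_simp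
  have h2 : q' / B * A < p + 1 := by rwa [div_mul_eq_mul_div, div_lt_iff₀ hB]
  exact ⟨h2.le, by linarith, Or.inl h2⟩

/-- No corner of the square lies strictly between the boundary direction `(βx, βy)` and the
helix direction `(A, B)`. -/
def CornerFree (A B βx βy p q : ℝ) : Prop :=
  ∀ x y, x = p ∨ x = p + 1 → y = q ∨ y = q + 1 → 0 < βx * y - βy * x → 0 < x * B - y * A → False

/-- A ray of the reversed curve that starts in the square `f` between the boundary line and the
helix, and whose line meets the helix at a parameter up to `r₁`, is impossible. -/
def Trapped (γ : ℝ → E3) (a A B βx βy : ℝ) (f : Frame) (p q r₁ : ℝ) : Prop :=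
  ∀ t x y dx dy s r, RayAt (fun s => γ (a - s)) f t (x - p) (y - q) dx dy →
    p < x → x ≤ p + 1 → q ≤ y → y ≤ q + 1 → (q < y ∨ 0 ≤ dy) → 0 ≤ βx * y - βy * x → 0 < s →
    x + s * dx = r * A → y + s * dy = r * B → 0 < r → r ≤ r₁ → 0 < dy * A - dx * B → False

/-- At the meeting point two passages of the simple curve coincide, so the reversed ray would have
to be antiparallel to (A, B). The sign in `hd` says that it crosses the helix transversally. -/
theorem hit_in_square (hγ : IsSimpleClosedQuasigeodesic γ L) (hA : 0 < A) (hB : 0 < B)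
    (hn : A ^ 2 + B ^ 2 = 1) (hR : Rep γ a A B f p q r₀ r₁) (hlt : r₀ < r₁) (hp : p ≤ r₀ * A)
    (hq : q ≤ r₀ * B) (hE : Exit A B p q r₁) {t x y dx dy s r : ℝ}
    (h : RayAt (fun s => γ (a - s)) f t (x - p) (y - q) dx dy) (hx : p ≤ x) (hx1 : x ≤ p + 1)
    (hy : q ≤ y) (hy1 : y ≤ q + 1) (hs : 0 < s) (e1 : x + s * dx = r * A)
    (e2 : y + s * dy = r * B) (hr : r₀ ≤ r) (hr1 : r ≤ r₁) (hd : 0 < dy * A - dx * B)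
    (hv : ∀ z ∈ Ioo 0 s, ∀ x' y', x + z * dx = x' → y + z * dy = y' → (x' = p ∨ x' = p + 1) →
      (y' = q ∨ y' = q + 1) → False) : False := by
  have hG := hγ.good
  have b1 : r₀ * A ≤ r * A := by gcongr
  have b2 : r₀ * B ≤ r * B := by gcongr
  have b3 : r * A ≤ r₁ * A := by gcongr
  have b4 : r * B ≤ r₁ * B := by gcongr
  have b5 : r₀ * A < r₁ * A := by gcongr
  have b6 : r₀ * B < r₁ * B := by gcongr
  have hE1 := hE.right
  have hE2 := hE.top
  have f1 : x - p + s * dx = -p + r * A := by linarith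
  have f2 : y - q + s * dy = -q + r * B := by linarith
  have hun := h.unit
  have hRay : Runs (fun s => γ (a - s)) f t (x - p) (y - q) dx dy 0 s := by
    refine (hG.reverse a).travel h.1 h.2 ⟨by linarith, by linarith⟩ ⟨by linarith, by linarith⟩
      (by rw [f1]; constructor <;> linarith) (by rw [f2]; constructor <;> linarith) ?_
    intro z hz
    rw [f.isVertex_chart]
    rintro ⟨h1, h2⟩
    refine hv z hz _ _ rfl rfl ?_ ?_
    · rcases h1 with h1 | h1
      · left; linarith
      · right; linarith
    · rcases h2 with h1 | h1
      · left; linarith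
      · right; linarith
  have hfor := hasBackwardDir_reverse.1 (hRay.backward hun hs le_rfl)
  have heq : γ (a - (t + s)) = γ (a + r) := by
    have h1 := hRay s ⟨hs.le, le_rfl⟩
    rw [f1, f2] at h1
    exact h1.trans (hR r ⟨hr, hr1⟩).symm
  have key : -dx = A ∧ -dy = B := by
    rcases hr1.lt_or_eq with hr1 | rfl
    · have h1 := hγ.forward_unique heq hfor (hR.forward hn hr hr1)
      rw [← f.lin_neg] at h1
      exact f.lin_injective h1
    -- At the end of the passage the helix may already continue in the next face. Its backward
    -- direction still lies in this square and is compared instead.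
    · have h1 := hγ.backward_of_eq heq (hR.backward hn hlt le_rfl)
      have h2 : γ (a - (t + s)) = f.chart (-p + r * A) (-q + r * B) :=
        heq.trans (hR r ⟨hlt.le, le_rfl⟩)
      rw [← f.lin_neg] at hfor
      refine hG.eq_of_same_face h2 ?_ h1 hfor
      rw [f.isVertex_chart]
      rintro ⟨h3 | h3, h4 | h4⟩ <;> rcases hE.strict with h5 | h5 <;> linarith
  obtain ⟨rfl, rfl⟩ := key
  linarith

/-- Along the segment both defining linear forms of the strip are affine. One is nonnegative at the
start and positive at the helix; the other vanishes only at the helix. -/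
theorem between {βx βy A B x y dx dy s r z : ℝ} (hβ : 0 < βx * B - βy * A)
    (h0 : 0 ≤ βx * y - βy * x) (e1 : x + s * dx = r * A) (e2 : y + s * dy = r * B) (hr : 0 < r)
    (hd : 0 < dy * A - dx * B) (hz : 0 < z) (hzs : z < s) :
    0 < βx * (y + z * dy) - βy * (x + z * dx) ∧ 0 < (x + z * dx) * B - (y + z * dy) * A := by
  have hs : 0 < s := hz.trans hzs
  constructor
  · have h1 : 0 < βx * (y + s * dy) - βy * (x + s * dx) := by
      rw [e1, e2]; have := mul_pos hr hβ; linarith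
    have h2 : s * (βx * (y + z * dy) - βy * (x + z * dx)) =
        (s - z) * (βx * y - βy * x) + z * (βx * (y + s * dy) - βy * (x + s * dx)) := by ring
    have h3 : 0 < s * (βx * (y + z * dy) - βy * (x + z * dx)) := by
      rw [h2]
      have := mul_nonneg (sub_nonneg.2 hzs.le) h0
      have := mul_pos hz h1
      linarith
    exact pos_of_mul_pos_right h3 hs.le
  · have h2 : (x + z * dx) * B - (y + z * dy) * A = (s - z) * (dy * A - dx * B) := by
      linear_combination B * e1 - A * e2
    rw [h2]
    exact mul_pos (sub_pos.2 hzs) hd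

theorem Trapped.start (hγ : IsSimpleClosedQuasigeodesic γ L) (hA : 0 < A) (hB : 0 < B)
    (hn : A ^ 2 + B ^ 2 = 1) (hβ : 0 < βx * B - βy * A) (hR : Rep γ a A B f 0 0 0 r₁)
    (hlt : 0 < r₁) (hE : Exit A B 0 0 r₁) (hc : CornerFree A B βx βy 0 0) :
    Trapped γ a A B βx βy f 0 0 r₁ := by
  intro t x y dx dy s r h hx hx1 hy hy1 _ h0 hs e1 e2 hr hr1 hd
  refine hit_in_square hγ hA hB hn hR hlt (by simp) (by simp) hE h hx.le hx1 hy hy1 hs e1 e2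
    hr.le hr1 hd ?_
  rintro z hz x' y' rfl rfl h1 h2
  have := between hβ h0 e1 e2 hr hd hz.1 hz.2
  exact hc _ _ h1 h2 this.1 this.2

/-- If the meeting point is not in this square, the ray leaves through the west edge. The ends of
that edge lie on or outside the two sides of the strip, so the ray crosses its interior and the
previous square takes over. -/
theorem Trapped.east (hγ : IsSimpleClosedQuasigeodesic γ L) (hA : 0 < A) (hB : 0 < B)
    (hn : A ^ 2 + B ^ 2 = 1) (hβ : 0 < βx * B - βy * A) (hβx : 0 < βx) {p' : ℝ}
    (hT : Trapped γ a A B βx βy f p q (p' / A)) (hR : Rep γ a A B f.rollE p' q (p' / A) r₁)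
    (hp : p + 1 = p') (hlt : p' / A < r₁) (hE : Exit A B p' q r₁)
    (hc : CornerFree A B βx βy p' q) (h1 : βx * q ≤ βy * p') (h2 : p' * B ≤ (q + 1) * A)
    (h3 : q * A ≤ p' * B) : Trapped γ a A B βx βy f.rollE p' q r₁ := by
  intro t x y dx dy s r h hx hx1 hy hy1 hqy h0 hs e1 e2 hr hr1 hd
  have hG := (hγ.good).reverse a
  have ep : p' / A * A = p' := by field_simp
  have hv : ∀ z, 0 < z → z < s → ∀ x' y', x + z * dx = x' → y + z * dy = y' →
      (x' = p' ∨ x' = p' + 1) → (y' = q ∨ y' = q + 1) → False := by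
    rintro z hz hz' x' y' rfl rfl h1 h2
    have := between hβ h0 e1 e2 hr hd hz hz'
    exact hc _ _ h1 h2 this.1 this.2
  rcases le_or_gt (p' / A) r with hpr | hpr
  · exact hit_in_square hγ hA hB hn hR hlt ep.ge
      (by rw [div_mul_eq_mul_div, le_div_iff₀ hA]; exact h3) hE h hx.le hx1 hy hy1 hs e1 e2
      hpr hr1 hd fun z hz => hv z hz.1 hz.2
  · have hlt' : r * A < p' := by rwa [lt_div_iff₀ hA] at hpr
    have hdx : dx < 0 := by
      by_contra hcon
      have := mul_nonneg hs.le (not_lt.1 hcon)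
      linarith
    set z := (x - p') / -dx with hz
    have hz0 : 0 < z := div_pos (by linarith) (by linarith)
    have ez : z * dx = p' - x := by
      rw [hz]; have := hdx.ne; field_simp; ring
    have hzs : z < s := by
      by_contra hcon
      have : z * dx ≤ s * dx := mul_le_mul_of_nonpos_right (not_lt.1 hcon) hdx.le
      linarith
    have hb := between hβ h0 e1 e2 hr hd hz0 hzs
    rw [ez, add_sub_cancel] at hb
    have hy0 : q < y + z * dy := by nlinarith
    have hy1' : y + z * dy < q + 1 := by nlinarith
    obtain ⟨t', ht'⟩ := h.west (y' := y + z * dy - q) hG hdx (by linarith) (by linarith)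
      ⟨by linarith, by linarith⟩ ⟨by linarith, by linarith⟩ (by linear_combination (-dy) * ez)
    refine hT t' p' (y + z * dy) dx dy (s - z) r (by rwa [← hp, add_sub_cancel_left])
      (by linarith) hp.ge hy0.le hy1'.le (Or.inl hy0) hb.1.le (by linarith) ?_ ?_ hr hpr.le hd
    · linarith
    · linarith

theorem Trapped.north (hγ : IsSimpleClosedQuasigeodesic γ L) (hA : 0 < A) (hB : 0 < B)
    (hn : A ^ 2 + B ^ 2 = 1) (hβ : 0 < βx * B - βy * A) (hβy : 0 < βy) {q' : ℝ}
    (hT : Trapped γ a A B βx βy f p q (q' / B)) (hR : Rep γ a A B f.rollN p q' (q' / B) r₁)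
    (hq : q + 1 = q') (hlt : q' / B < r₁) (hE : Exit A B p q' r₁)
    (hc : CornerFree A B βx βy p q') (h1 : βx * q' ≤ βy * (p + 1)) (h2 : p * B ≤ q' * A) :
    Trapped γ a A B βx βy f.rollN p q' r₁ := by
  intro t x y dx dy s r h hx hx1 hy hy1 hqy h0 hs e1 e2 hr hr1 hd
  have hG := (hγ.good).reverse a
  have ep : q' / B * B = q' := by field_simp
  have hv : ∀ z, 0 < z → z < s → ∀ x' y', x + z * dx = x' → y + z * dy = y' →
      (x' = p ∨ x' = p + 1) → (y' = q' ∨ y' = q' + 1) → False := by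
    rintro z hz hz' x' y' rfl rfl h1 h2
    have := between hβ h0 e1 e2 hr hd hz hz'
    exact hc _ _ h1 h2 this.1 this.2
  rcases le_or_gt (q' / B) r with hpr | hpr
  · exact hit_in_square hγ hA hB hn hR hlt
      (by rw [div_mul_eq_mul_div, le_div_iff₀ hB]; exact h2) ep.ge hE h hx.le hx1 hy hy1 hs e1 e2
      hpr hr1 hd fun z hz => hv z hz.1 hz.2
  · have hlt' : r * B < q' := by rwa [lt_div_iff₀ hB] at hpr
    have hdy : dy < 0 := by
      by_contra hcon
      have := mul_nonneg hs.le (not_lt.1 hcon)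
      linarith
    have hy' : q' < y := hqy.resolve_right (not_le.2 hdy)
    set z := (y - q') / -dy with hz
    have hz0 : 0 < z := div_pos (by linarith) (by linarith)
    have ez : z * dy = q' - y := by
      rw [hz]; have := hdy.ne; field_simp; ring
    have hzs : z < s := by
      by_contra hcon
      have : z * dy ≤ s * dy := mul_le_mul_of_nonpos_right (not_lt.1 hcon) hdy.le
      linarith
    have hb := between hβ h0 e1 e2 hr hd hz0 hzs
    rw [ez, add_sub_cancel] at hb
    have hx0 : p < x + z * dx := by nlinarith
    have hx1' : x + z * dx < p + 1 := by nlinarith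
    obtain ⟨t', ht'⟩ := h.south (x' := x + z * dx - p) hG hdy (by linarith) (by linarith)
      ⟨by linarith, by linarith⟩ ⟨by linarith, by linarith⟩ (by linear_combination (-dx) * ez)
    refine hT t' (x + z * dx) q' dx dy (s - z) r (by rwa [← hq, add_sub_cancel_left])
      hx0 hx1'.le (by linarith) hq.ge (Or.inl (by linarith)) hb.1.le (by linarith) ?_ ?_ hr hpr.le hd
    · linarith
    · linarith

/-- Cramer's rule gives the parameters of the meeting point; the sign conditions place it ahead on
the ray and on the known part of the helix. -/
theorem Trapped.elim {t x y dx dy : ℝ} (hT : Trapped γ a A B βx βy f p q r₁)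
    (h : RayAt (fun s => γ (a - s)) f t (x - p) (y - q) dx dy) (hx : p < x) (hx1 : x ≤ p + 1)
    (hy : q ≤ y) (hy1 : y ≤ q + 1) (hqy : q < y ∨ 0 ≤ dy) (h0 : 0 ≤ βx * y - βy * x)
    (hz : 0 < x * B - y * A) (hd : 0 < dy * A - dx * B) (hr : 0 < x * dy - y * dx)
    (hr1 : x * dy - y * dx ≤ r₁ * (dy * A - dx * B)) : False := by
  refine hT t x y dx dy ((x * B - y * A) / (dy * A - dx * B))
    ((x * dy - y * dx) / (dy * A - dx * B)) h hx hx1 hy hy1 hqy h0 (div_pos hz hd) ?_ ?_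
    (div_pos hr hd) (by rwa [div_le_iff₀ hd]) hd <;>
  · have := hd.ne'
    rw [div_mul_eq_mul_div, div_mul_eq_mul_div, eq_div_iff this, add_mul, div_mul_cancel₀ _ this]
    ring

/-- No ray leaves a boundary vertex into the square to its upper left. -/
theorem Trapped.not_west {t c d : ℝ} (hA : 0 < A) (hB : 0 < B) {p' : ℝ}
    (hT : Trapped γ a A B βx βy f p q (p' / A)) (hp : p + 1 = p') (hp0 : 0 < p') (hq0 : 0 ≤ q)
    (hβ : βx * q = βy * p') (hz : q * A < p' * B)
    (h : RayAt (fun s => γ (a - s)) f t 1 0 (-d) c) (hc : 0 ≤ c) (hd : 0 ≤ d)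
    (hcd : 0 < c ∨ 0 < q * d) : False := by
  have hd' : 0 < c * A - -d * B := by
    rcases hcd with h | h
    · have := mul_pos h hA
      have := mul_nonneg hd hB.le
      linarith
    · have := mul_pos (pos_of_mul_pos_right h hq0) hB
      have := mul_nonneg hc hA.le
      linarith
  have e1 : p' - p = 1 := by linarith
  refine hT.elim (t := t) (x := p') (y := q) (dx := -d) (dy := c) (by rwa [e1, sub_self])
    (by linarith) hp.ge le_rfl (by linarith) (Or.inr hc) (by linarith) (by linarith) hd' ?_ ?_
  · rcases hcd with h | h
    · have := mul_pos hp0 h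
      have := mul_nonneg hq0 hd
      linarith
    · have := mul_nonneg hp0.le hc
      linarith
  · rw [div_mul_eq_mul_div, le_div_iff₀ hA]
    have := mul_nonneg hd (sub_pos.2 hz).le
    linarith

/-- No ray leaves a boundary vertex into the part of the square to its lower left above the
boundary. -/
theorem Trapped.not_south {t c d : ℝ} (hA : 0 < A) (hB : 0 < B) {p' q' : ℝ} (hβx : 0 < βx)
    (hh : 0 < βx * B - βy * A)
    (hT : Trapped γ a A B βx βy f p q (q' / B)) (hp : p + 1 = p') (hq : q + 1 = q') (hp0 : 0 < p')
    (hβ : βx * q' = βy * p')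
    (h : RayAt (fun s => γ (a - s)) f t 1 1 (-c) (-d)) (hc : 0 ≤ c) (hd : 0 ≤ d)
    (hcd : βx * d < βy * c) : False := by
  have e1 : p' - p = 1 := by linarith
  have e2 : q' - q = 1 := by linarith
  have hz : 0 < p' * B - q' * A := by
    have h1 : 0 < βx * (p' * B - q' * A) := by
      rw [show βx * (p' * B - q' * A) = p' * (βx * B - βy * A) by linear_combination (-A) * hβ]
      exact mul_pos hp0 hh
    exact pos_of_mul_pos_right h1 hβx.le
  have hd' : 0 < -d * A - -c * B := by
    have h1 : 0 < βx * (-d * A - -c * B) := by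
      rw [show βx * (-d * A - -c * B) = A * (βy * c - βx * d) + c * (βx * B - βy * A) by ring]
      have := mul_pos hA (sub_pos.2 hcd)
      have := mul_nonneg hc hh.le
      linarith
    exact pos_of_mul_pos_right h1 hβx.le
  refine hT.elim (t := t) (x := p') (y := q') (dx := -c) (dy := -d) (by rwa [e1, e2])
    (by linarith) hp.ge (by linarith) hq.ge (Or.inl (by linarith)) (by linarith) hz hd' ?_ ?_
  · have h1 : 0 < βx * (p' * -d - q' * -c) := by
      rw [show βx * (p' * -d - q' * -c) = p' * (βy * c - βx * d) by linear_combination c * hβ]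
      exact mul_pos hp0 (sub_pos.2 hcd)
    exact pos_of_mul_pos_right h1 hβx.le
  · rw [div_mul_eq_mul_div, le_div_iff₀ hB]
    have := mul_nonneg hd hz.le
    linarith

end

/-! ### The reversed curve at the vertices on the boundary of the strip. -/

section
variable {γ : ℝ → E3} {L a A B : ℝ} {f : Frame} {p q p' q' : ℝ} {βx βy t u v c d : ℝ}

theorem CornerAt.start (h0 : γ a = f.chart 0 0) (hf : HasForwardDir γ a (f.lin A B)) :
    CornerAt (fun s => γ (a - s)) f 0 A B :=
  ⟨by simpa using h0, hasBackwardDir_reverse.2 (by simpa using hf)⟩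

/-- The reversed curve returns to its start only the way it left. -/
theorem CornerAt.eq_start (hγ : IsSimpleClosedQuasigeodesic γ L) (h0 : γ a = f.chart 0 0)
    (hf : HasForwardDir γ a (f.lin A B)) (h : CornerAt (fun s => γ (a - s)) f t c d) :
    c = A ∧ d = B :=
  f.lin_injective (hγ.forward_unique (h.1.trans h0.symm) (hasBackwardDir_reverse.1 h.2) hf)

theorem not_west_of_rot (hA : 0 < A) (hB : 0 < B)
    (hT : Trapped γ a A B βx βy f p q (p' / A)) (hp : p + 1 = p') (hp0 : 0 < p') (hq0 : 0 ≤ q)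
    (hβ : βx * q = βy * p') (hz : q * A < p' * B)
    (h : (fun s => γ (a - s)) t = f.rollE.chart 0 0)
    (h' : HasForwardDir (fun s => γ (a - s)) t (f.rollE.rot.lin c d)) (hc : 0 ≤ c) (hd : 0 ≤ d)
    (hcd : 0 < c ∨ 0 < q * d) : False :=
  hT.not_west hA hB hp hp0 hq0 hβ hz ⟨h.trans (f.chart_rollE 0), by rwa [f.lin_rollE_rot] at h'⟩
    hc hd hcd

/-- At a boundary vertex the reversed curve turns to the square at the lower left. -/
theorem CornerAt.south_west (hγ : IsSimpleClosedQuasigeodesic γ L) (hA : 0 < A) (hB : 0 < B)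
    (h : CornerAt (fun s => γ (a - s)) f.rollN.rollE t u v) (hu : 0 < u) (hv : 0 ≤ v)
    (hT : Trapped γ a A B βx βy f.rollN p q (p' / A)) (hp : p + 1 = p') (hp0 : 0 < p')
    (hq0 : 0 < q) (hβ : βx * q = βy * p') (hz : q * A < p' * B) :
    ∃ c d, 0 ≤ c ∧ 0 ≤ d ∧ c ^ 2 + d ^ 2 = 1 ∧ u * d ≤ v * c ∧
      RayAt (fun s => γ (a - s)) f t 1 1 (-c) (-d) := by
  obtain ⟨c, d, hc, hd, hn, h1 | ⟨h1, h2⟩⟩ := h.next ((hγ.good).reverse a) hu hv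
  · refine (not_west_of_rot hA hB hT hp hp0 hq0.le hβ hz h.1 h1 hc hd ?_).elim
    rcases hc.eq_or_lt with rfl | hc
    · right
      refine mul_pos hq0 (hd.lt_of_ne ?_)
      rintro rfl
      norm_num at hn
    · exact Or.inl hc
  · refine ⟨c, d, hc, hd, hn, h2, ?_, by rwa [f.lin_rollN_rollE_rot_rot] at h1⟩
    rw [← f.chart_rollN, ← f.rollN.chart_rollE]
    exact h.1

/-- A reversed curve that reaches a boundary vertex along the boundary continues along it. -/
theorem CornerAt.boundary (hγ : IsSimpleClosedQuasigeodesic γ L) (hA : 0 < A) (hB : 0 < B)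
    (hβx : 0 < βx) (hβy : 0 < βy) (hh : 0 < βx * B - βy * A)
    (h : CornerAt (fun s => γ (a - s)) f.rollN.rollE t u v) (hu : 0 < u) (huv : βx * v = βy * u)
    (hT : Trapped γ a A B βx βy f.rollN p q' (p' / A))
    (hS : Trapped γ a A B βx βy f p q (q' / B))
    (hp : p + 1 = p') (hq : q + 1 = q') (hp0 : 0 < p') (hq0 : 0 < q') (hβ : βx * q' = βy * p') :
    ∃ c d, 0 < c ∧ 0 < d ∧ βx * d = βy * c ∧ RayAt (fun s => γ (a - s)) f t 1 1 (-c) (-d) := by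
  have hz : q' * A < p' * B := by
    have h1 : 0 < βx * (p' * B - q' * A) := by
      rw [show βx * (p' * B - q' * A) = p' * (βx * B - βy * A) by linear_combination (-A) * hβ]
      exact mul_pos hp0 hh
    linarith [pos_of_mul_pos_right h1 hβx.le]
  have hv : 0 < v := by
    have : 0 < βx * v := huv ▸ mul_pos hβy hu
    exact pos_of_mul_pos_right this hβx.le
  obtain ⟨c, d, hc, hd, hn, h1, h2⟩ := h.south_west hγ hA hB hu hv.le hT hp hp0 hq0 hβ hz
  -- The right angle condition keeps the ray on or below the boundary, while `Trapped.not_south`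
  -- keeps it on or above.
  have h3 : βx * d ≤ βy * c := by
    have : u * (βy * c - βx * d) = βx * (v * c - u * d) := by linear_combination (-c) * huv
    have h4 : 0 ≤ u * (βy * c - βx * d) := this ▸ mul_nonneg hβx.le (sub_nonneg.2 h1)
    linarith [nonneg_of_mul_nonneg_right h4 hu]
  rcases h3.lt_or_eq with h4 | h4
  · exact (hS.not_south hA hB hβx hh hp hq hp0 hβ h2 hc hd h4).elim
  · have hc' : c ≠ 0 := by
      rintro rfl
      rw [mul_zero] at h4
      rcases mul_eq_zero.1 h4 with h | h
      · exact hβx.ne' h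
      · subst h; norm_num at hn
    have hd' : d ≠ 0 := by
      rintro rfl
      rw [mul_zero] at h4
      exact mul_ne_zero hβy.ne' hc' h4.symm
    exact ⟨c, d, hc.lt_of_ne hc'.symm, hd.lt_of_ne hd'.symm, h4, h2⟩

/-- A ray that passes around the vertex of a square re-enters the strip a quarter turn later. -/
theorem RayAt.turn {G : ℝ → E3} (hG : Good G) {x y ξ : ℝ}
    (h : RayAt G f.rollN.rollE t x y (-c) (-d)) (hd : 0 < d) (hy : 0 < y) (hy1 : y ≤ 1)
    (hx : x ∈ Icc (0 : ℝ) 1) (hξ : ξ ∈ Ioo (0 : ℝ) 1) (e : ξ * d = x * d - y * c) :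
    ∃ t', RayAt G f t' 1 (1 - ξ) (-d) c := by
  have e1 : f.rollN.rollE = f.swap.flipX.rollN := by
    simp [Frame.rollE, Frame.rollN, Frame.flipX, Frame.swap]
  rw [e1] at h
  obtain ⟨t', h1, h2⟩ := h.south (x' := ξ) hG (neg_neg_of_pos hd) hy hy1 hx hξ (by linarith)
  refine ⟨t', ?_, ?_⟩
  · rw [h1, Frame.chart_flipX, Frame.chart_swap]
  · rwa [Frame.lin_flipX, Frame.lin_swap, neg_neg] at h2

/-- This treats a boundary that consists of edges of the cube. The square to the upper left is
closed off by `hT`, which leaves the edge itself or the face below. The edge appears both in `rot`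
(c = 0) and in `rot.rot` (d = 0). -/
theorem CornerAt.edge (hγ : IsSimpleClosedQuasigeodesic γ L) (hA : 0 < A) (hB : 0 < B)
    (h : CornerAt (fun s => γ (a - s)) f.rollE t u v) (hu : 0 < u) (hv : 0 ≤ v)
    (hT : Trapped γ a A B 1 0 f p 0 (p' / A)) (hp : p + 1 = p') (hp0 : 0 < p') :
    (∃ t', CornerAt (fun s => γ (a - s)) f t' 1 0) ∨ ∃ c d, 0 < c ∧ 0 < d ∧ u * d ≤ v * c ∧
      RayAt (fun s => γ (a - s)) f.rollE.rot.rot t 0 0 c d := by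
  have hG := (hγ.good).reverse a
  have edge : HasForwardDir (fun s => γ (a - s)) t (f.lin (-1) 0) →
      ∃ t', CornerAt (fun s => γ (a - s)) f t' 1 0 := fun h1 =>
    RayAt.corner (x := 1) (y := 0) (d := 0) hG ⟨h.1.trans (f.chart_rollE 0), by rwa [neg_zero]⟩
      one_pos one_pos le_rfl (by simp) (by simp)
  obtain ⟨c, d, hc, hd, hn, h1 | ⟨h1, h2⟩⟩ := h.next hG hu hv
  · rcases hc.eq_or_lt with rfl | hc'
    · left
      obtain rfl : d = 1 := by nlinarith
      exact edge (by rwa [f.lin_rollE_rot] at h1)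
    · exact (not_west_of_rot hA hB hT hp hp0 le_rfl (by simp)
        (by rw [zero_mul]; exact mul_pos hp0 hB) h.1 h1 hc hd (Or.inl hc')).elim
  · rcases hd.eq_or_lt with rfl | hd'
    · left
      obtain rfl : c = 1 := by nlinarith
      exact edge (by rwa [f.lin_rollE_rot_rot] at h1)
    · right
      refine ⟨c, d, hc.lt_of_ne ?_, hd', h2, h.1.trans ?_, h1⟩
      · rintro rfl
        have := mul_pos hu hd'
        linarith
      · apply f.ext_coord <;>
          simp [Frame.chart, Frame.rollE, Frame.rot, f.hij, f.hij.symm, f.hik, f.hik.symm, f.hjk,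
            f.hjk.symm]

/-! ### The four helices. -/

/-- Four rolls to the east restore `f`, so the start vertex reappears at (4, 0), and the boundary
follows four edges around the face below. -/
theorem helix_four (hγ : IsSimpleClosedQuasigeodesic γ L) (hA : 0 < A) (hB : 0 < B)
    (hn : A ^ 2 + B ^ 2 = 1) (h0 : γ a = f.chart 0 0) (hf : HasForwardDir γ a (f.lin A B))
    (hm : 4 * B < A)
    (R0 : Rep γ a A B f 0 0 0 (1 / A))
    (R1 : Rep γ a A B f.rollE 1 0 (1 / A) (2 / A))
    (R2 : Rep γ a A B f.rollE.rollE 2 0 (2 / A) (3 / A))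
    (R3 : Rep γ a A B f.rollE.rollE.rollE 3 0 (3 / A) (4 / A)) : False := by
  have hG := (hγ.good).reverse a
  have hβ : 0 < (1 : ℝ) * B - 0 * A := by linarith
  have T0 := Trapped.start hγ hA hB hn hβ R0 (by positivity)
    (Exit.east hA (by norm_num) (by linarith))
    (by rintro x y (rfl | rfl) (rfl | rfl) h1 h2 <;> linarith)
  have T1 := T0.east hγ hA hB hn hβ one_pos R1 (by norm_num) (by gcongr; norm_num)
    (Exit.east hA (by norm_num) (by linarith))
    (by rintro x y (rfl | rfl) (rfl | rfl) h1 h2 <;> linarith) (by norm_num) (by linarith)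
    (by linarith)
  have T2 := T1.east hγ hA hB hn hβ one_pos R2 (by norm_num) (by gcongr; norm_num)
    (Exit.east hA (by norm_num) (by linarith))
    (by rintro x y (rfl | rfl) (rfl | rfl) h1 h2 <;> linarith) (by norm_num) (by linarith)
    (by linarith)
  have T3 := T2.east hγ hA hB hn hβ one_pos R3 (by norm_num) (by gcongr; norm_num)
    (Exit.east hA (by norm_num) (by linarith))
    (by rintro x y (rfl | rfl) (rfl | rfl) h1 h2 <;> linarith) (by norm_num) (by linarith)
    (by linarith)
  have e : f.rollE.rollE.rollE.rollE = f := by simp [Frame.rollE]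
  have step : ∀ {g : Frame} {p p' t : ℝ}, Trapped γ a A B 1 0 g p 0 (p' / A) → p + 1 = p' →
      0 < p' → CornerAt (fun s => γ (a - s)) g.rollE t 1 0 →
      ∃ t', CornerAt (fun s => γ (a - s)) g t' 1 0 := by
    intro g p p' t hT hp hp0 h
    rcases h.edge hγ hA hB one_pos le_rfl hT hp hp0 with h1 | ⟨c, d, -, hd, h1, -⟩
    · exact h1
    · linarith
  have hs := CornerAt.start h0 hf
  rw [← e] at hs
  rcases hs.edge hγ hA hB hA hB.le T3 (by norm_num) (by norm_num) with ⟨t₃, h3⟩ |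
    ⟨c, d, hc, hd, h1, h2⟩
  · obtain ⟨t₂, h2⟩ := step T2 (by norm_num) (by norm_num) h3
    obtain ⟨t₁, h1⟩ := step T1 (by norm_num) (by norm_num) h2
    obtain ⟨t₀, h0'⟩ := step T0 (by norm_num) (by norm_num) h1
    exact hB.ne (h0'.eq_start hγ h0 hf).2
  -- The ray enters the face below with slope τ ≤ B / A. It leaves through the opposite edge, which
  -- borders the square at (2, 0), and emerges at (3 - τ, 0) going up and to the left.
  · obtain ⟨τ, rfl⟩ : ∃ τ, d = τ * c := ⟨d / c, by field_simp⟩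
    have hτ : 0 < τ := pos_of_mul_pos_left hd hc.le
    have hτ1 : τ * A ≤ B := le_of_mul_le_mul_right (by linarith) hc
    have hτ4 : τ < 1 := by nlinarith
    have h3 : RayAt (fun s => γ (a - s)) f.rollE.rollE.rollE.rollE.rot.rot.swap 0 0 0 (τ * c) c := by
      rwa [RayAt, Frame.chart_swap, Frame.lin_swap]
    obtain ⟨t', h4⟩ := h3.north (x' := τ) hG hc le_rfl one_pos (by simp) ⟨hτ, hτ4⟩ (by ring)
    have e2 : f.rollE.rollE.rollE.rollE.rot.rot.swap.rollN = f.rollE.rollE.flipX := by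
      simp [Frame.rollE, Frame.rollN, Frame.flipX, Frame.swap, Frame.rot]
    rw [e2, RayAt, Frame.chart_flipX, Frame.lin_flipX] at h4
    have h5 : RayAt (fun s => γ (a - s)) f.rollE.rollE t' (1 - τ) 0 (-(τ * c)) c := h4
    refine T2.elim (t := t') (x := 3 - τ) (y := 0) (dx := -(τ * c)) (dy := c) ?_ (by linarith)
      (by linarith) le_rfl (by norm_num) (Or.inr hc.le) (by norm_num) ?_ ?_ ?_ ?_
    · convert h5 using 1 <;> ring
    · nlinarith
    · have := mul_pos hc hA
      have := mul_pos hd hB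
      linarith
    · nlinarith
    · rw [div_mul_eq_mul_div, le_div_iff₀ hA]
      have := mul_pos hd hB
      have := mul_pos hd hA
      linarith

/-- The start vertex reappears at (4, 2), and the boundary passes through the vertex (2, 1). -/
theorem helix_four_two (hγ : IsSimpleClosedQuasigeodesic γ L) (hA : 0 < A) (hB : 0 < B)
    (hn : A ^ 2 + B ^ 2 = 1) (h0 : γ a = f.chart 0 0) (hf : HasForwardDir γ a (f.lin A B))
    (hm : A < 2 * B) (hm' : 3 * B < 2 * A)
    (R0 : Rep γ a A B f 0 0 0 (1 / A))
    (R1 : Rep γ a A B f.rollE 1 0 (1 / A) (1 / B))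
    (R2 : Rep γ a A B f.rollE.rollN 1 1 (1 / B) (2 / A))
    (R3 : Rep γ a A B f.rollE.rollN.rollE 2 1 (2 / A) (3 / A))
    (R4 : Rep γ a A B f.rollE.rollN.rollE.rollE 3 1 (3 / A) (2 / B))
    (R5 : Rep γ a A B f.rollE.rollN.rollE.rollE.rollN 3 2 (2 / B) (4 / A)) : False := by
  have hG := (hγ.good).reverse a
  have hβ : 0 < (2 : ℝ) * B - 1 * A := by linarith
  have T0 := Trapped.start hγ hA hB hn hβ R0 (by positivity)
    (Exit.east hA (by norm_num) (by linarith))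
    (by rintro x y (rfl | rfl) (rfl | rfl) h1 h2 <;> linarith)
  have T1 := T0.east hγ hA hB hn hβ two_pos R1 (by norm_num)
    (by rw [div_lt_div_iff₀ hA hB]; linarith) (Exit.north hB (by norm_num) (by linarith))
    (by rintro x y (rfl | rfl) (rfl | rfl) h1 h2 <;> linarith) (by norm_num) (by linarith)
    (by linarith)
  have T2 := T1.north hγ hA hB hn hβ one_pos R2 (by norm_num)
    (by rw [div_lt_div_iff₀ hB hA]; linarith) (Exit.east hA (by norm_num) (by linarith))
    (by rintro x y (rfl | rfl) (rfl | rfl) h1 h2 <;> linarith) (by norm_num) (by linarith)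
  have T3 := T2.east hγ hA hB hn hβ two_pos R3 (by norm_num)
    (by gcongr; norm_num) (Exit.east hA (by norm_num) (by linarith))
    (by rintro x y (rfl | rfl) (rfl | rfl) h1 h2 <;> linarith) (by norm_num) (by linarith)
    (by linarith)
  have T4 := T3.east hγ hA hB hn hβ two_pos R4 (by norm_num)
    (by rw [div_lt_div_iff₀ hA hB]; linarith) (Exit.north hB (by norm_num) (by linarith))
    (by rintro x y (rfl | rfl) (rfl | rfl) h1 h2 <;> linarith) (by norm_num) (by linarith)
    (by linarith)
  have T5 := T4.north hγ hA hB hn hβ one_pos R5 (by norm_num)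
    (by rw [div_lt_div_iff₀ hB hA]; linarith) (Exit.east hA (by norm_num) (by linarith))
    (by rintro x y (rfl | rfl) (rfl | rfl) h1 h2 <;> linarith) (by norm_num) (by linarith)
  have e : f.rollE.rollN.rollE.rollE.rollN.rollE = f := by simp [Frame.rollE, Frame.rollN]
  have hs := CornerAt.start h0 hf
  rw [← e] at hs
  obtain ⟨c, d, hc, hd, hn', h1, h2⟩ := hs.south_west hγ hA hB hA hB.le T5 (by norm_num)
    (by norm_num) (by norm_num) (by norm_num) (by linarith)
  rcases lt_or_ge (2 * d) (1 * c) with h3 | h3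
  · exact T4.not_south (p' := 4) hA hB two_pos hβ (by norm_num) (by norm_num) (by norm_num) (by norm_num)
      h2 hc hd h3
  have hc : 0 < c := by
    refine hc.lt_of_ne ?_
    rintro rfl
    obtain rfl : d = 1 := by nlinarith
    linarith
  obtain ⟨τ, rfl⟩ : ∃ τ, d = τ * c := ⟨d / c, by field_simp⟩
  have hτ : 1 / 2 ≤ τ := le_of_mul_le_mul_right (by linarith) hc
  have hτ1 : τ * A ≤ B := le_of_mul_le_mul_right (by linarith) hc
  have hτ2 : τ < 2 / 3 := by nlinarith
  have hτc : 0 < τ * c := by positivity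
  obtain ⟨t₁, h4⟩ := h2.west (y' := 1 - τ) hG (by linarith) one_pos le_rfl (by simp)
    ⟨by linarith, by linarith⟩ (by ring)
  -- For τ = 1/2 the ray runs along the boundary and is led back to the origin in direction (2, 1),
  -- which is not (A, B). Otherwise it passes below (2, 1).
  rcases hτ.eq_or_lt with h5 | h5
  · obtain ⟨t₂, h6⟩ := h4.corner hG hc one_pos le_rfl ⟨by linarith, by linarith⟩
      (by rw [← h5]; ring)
    obtain ⟨c', d', hc', hd', h7, h8⟩ := h6.boundary hγ hA hB two_pos one_pos hβ hc
      (by rw [← h5]; ring) T2 T1 (by norm_num) (by norm_num) (by norm_num) (by norm_num)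
      (by norm_num)
    obtain ⟨t₃, h9⟩ := h8.west (y' := 1 / 2) hG (by linarith) one_pos le_rfl (by simp)
      ⟨by norm_num, by norm_num⟩ (by linarith)
    obtain ⟨t₄, h10⟩ := h9.corner hG hc' one_pos le_rfl ⟨by norm_num, by norm_num⟩ (by linarith)
    obtain ⟨rfl, rfl⟩ := h10.eq_start hγ h0 hf
    linarith
  · have hτ' : 0 < τ := by linarith
    have i1 : 1 / τ < 2 := by rw [div_lt_iff₀ hτ']; linarith
    have i2 : 1 < 1 / τ := by rw [lt_div_iff₀ hτ']; linarith
    have i3 : 1 / τ * τ = 1 := by field_simp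
    -- The clockwise quarter turn about (2, 1) takes (4 - 1/τ, 1) to (2, 1/τ - 1). From there the
    -- ray has direction (-τ, 1) and passes (3 - 2τ, 1), inside the strip.
    obtain ⟨t₂, h6⟩ := h4.turn (ξ := 2 - 1 / τ) hG hτc (by linarith) (by linarith) (by simp)
      ⟨by linarith, by linarith⟩ (by linear_combination (-c) * i3)
    obtain ⟨t₃, h7⟩ := h6.north (x' := 2 - 2 * τ) hG hc (by linarith) (by linarith) (by simp)
      ⟨by linarith, by linarith⟩ (by linear_combination (-c) * i3)
    refine T2.elim (t := t₃) (x := 3 - 2 * τ) (y := 1) (dx := -(τ * c)) (dy := c) ?_ (by linarith)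
      (by linarith) le_rfl (by norm_num) (Or.inr hc.le) (by linarith) ?_ ?_ ?_ ?_
    · convert h7 using 1 <;> ring
    · nlinarith
    · have := mul_pos hc hA
      have := mul_pos hτc hB
      linarith
    · nlinarith
    · rw [div_mul_eq_mul_div, le_div_iff₀ hA]
      nlinarith [mul_pos hτc hB, mul_pos hc hA]

/-- The start vertex reappears at (2, 4), and the boundary passes through (1, 2). The slope exceeds
2 because the lemma serves the segment reflected in the diagonal. -/
theorem helix_two_four (hγ : IsSimpleClosedQuasigeodesic γ L) (hA : 0 < A) (hB : 0 < B)
    (hn : A ^ 2 + B ^ 2 = 1) (h0 : γ a = f.chart 0 0) (hf : HasForwardDir γ a (f.lin A B))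
    (hm : 2 * A < B) (hm' : 2 * B < 5 * A)
    (R0 : Rep γ a A B f 0 0 0 (1 / B))
    (R1 : Rep γ a A B f.rollN 0 1 (1 / B) (2 / B))
    (R2 : Rep γ a A B f.rollN.rollN 0 2 (2 / B) (1 / A))
    (R3 : Rep γ a A B f.rollN.rollN.rollE 1 2 (1 / A) (3 / B))
    (R4 : Rep γ a A B f.rollN.rollN.rollE.rollN 1 3 (3 / B) (4 / B))
    (R5 : Rep γ a A B f.rollN.rollN.rollE.rollN.rollN 1 4 (4 / B) (2 / A)) : False := by
  have hG := (hγ.good).reverse a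
  have hβ : 0 < (1 : ℝ) * B - 2 * A := by linarith
  have E1 : Exit A B 0 1 (2 / B) := Exit.north hB (by norm_num) (by linarith)
  have T0 := Trapped.start hγ hA hB hn hβ R0 (by positivity)
    (Exit.north hB (by norm_num) (by linarith))
    (by rintro x y (rfl | rfl) (rfl | rfl) h1 h2 <;> linarith)
  have T1 := T0.north hγ hA hB hn hβ two_pos R1 (by norm_num)
    (by gcongr; norm_num) E1
    (by rintro x y (rfl | rfl) (rfl | rfl) h1 h2 <;> linarith) (by norm_num) (by linarith)
  have T2 := T1.north hγ hA hB hn hβ two_pos R2 (by norm_num)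
    (by rw [div_lt_div_iff₀ hB hA]; linarith) (Exit.east hA (by norm_num) (by linarith))
    (by rintro x y (rfl | rfl) (rfl | rfl) h1 h2 <;> linarith) (by norm_num) (by linarith)
  have T3 := T2.east hγ hA hB hn hβ one_pos R3 (by norm_num)
    (by rw [div_lt_div_iff₀ hA hB]; linarith) (Exit.north hB (by norm_num) (by linarith))
    (by rintro x y (rfl | rfl) (rfl | rfl) h1 h2 <;> linarith) (by norm_num) (by linarith)
    (by linarith)
  have T4 := T3.north hγ hA hB hn hβ two_pos R4 (by norm_num)
    (by gcongr; norm_num) (Exit.north hB (by norm_num) (by linarith))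
    (by rintro x y (rfl | rfl) (rfl | rfl) h1 h2 <;> linarith) (by norm_num) (by linarith)
  have T5 := T4.north hγ hA hB hn hβ two_pos R5 (by norm_num)
    (by rw [div_lt_div_iff₀ hB hA]; linarith) (Exit.east hA (by norm_num) (by linarith))
    (by rintro x y (rfl | rfl) (rfl | rfl) h1 h2 <;> linarith) (by norm_num) (by linarith)
  have e : f.rollN.rollN.rollE.rollN.rollN.rollE = f := by simp [Frame.rollE, Frame.rollN]
  have hs := CornerAt.start h0 hf
  rw [← e] at hs
  obtain ⟨c, d, hc, hd, hn', h1, h2⟩ := hs.south_west hγ hA hB hA hB.le T5 (by norm_num)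
    (by norm_num) (by norm_num) (by norm_num) (by linarith)
  rcases lt_or_ge (1 * d) (2 * c) with h3 | h3
  · exact T4.not_south (p' := 2) hA hB one_pos hβ (by norm_num) (by norm_num) (by norm_num) (by norm_num)
      h2 hc hd h3
  have hc : 0 < c := by
    refine hc.lt_of_ne ?_
    rintro rfl
    obtain rfl : d = 1 := by nlinarith
    linarith
  obtain ⟨τ, rfl⟩ : ∃ τ, d = τ * c := ⟨d / c, by field_simp⟩
  have hτ : 2 ≤ τ := le_of_mul_le_mul_right (by linarith) hc
  have hτ1 : τ * A ≤ B := le_of_mul_le_mul_right (by linarith) hc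
  have hτ2 : τ < 5 / 2 := by nlinarith
  have hτ' : 0 < τ := by linarith
  have hτc : 0 < τ * c := by positivity
  have i1 : 1 / τ ≤ 1 / 2 := by rw [div_le_div_iff₀ hτ' two_pos]; linarith
  have i2 : 0 < 1 / τ := by positivity
  have i3 : 1 / τ * τ = 1 := by field_simp
  obtain ⟨t₁, h4⟩ := h2.south (x' := 1 - 1 / τ) hG (by linarith) one_pos le_rfl (by simp)
    ⟨by linarith, by linarith⟩ (by linear_combination (-c) * i3)
  rcases hτ.eq_or_lt with h5 | h5
  · subst h5
    obtain ⟨t₂, h6⟩ := h4.corner hG hc (by norm_num) (by norm_num) (by simp) (by ring)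
    obtain ⟨c', d', hc', hd', h7, h8⟩ := h6.boundary hγ hA hB one_pos two_pos hβ hc
      (by ring) T2 T1 (by norm_num) (by norm_num) (by norm_num) (by norm_num)
      (by norm_num)
    obtain ⟨t₃, h9⟩ := h8.south (x' := 1 / 2) hG (by linarith) one_pos le_rfl (by simp)
      ⟨by norm_num, by norm_num⟩ (by linarith)
    obtain ⟨t₄, h10⟩ := h9.corner hG hc' (by norm_num) (by norm_num) (by simp) (by linarith)
    obtain ⟨rfl, rfl⟩ := h10.eq_start hγ h0 hf
    linarith
  · have i4 : 1 / τ < 1 / 2 := by rw [div_lt_div_iff₀ hτ' two_pos]; linarith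
    -- The quarter turn about (1, 2) takes (2 - 2/τ, 2) to (1, 1 + 2/τ).
    obtain ⟨t₂, h6⟩ := h4.turn (ξ := 1 - 2 * (1 / τ)) hG hτc one_pos le_rfl
      ⟨by linarith, by linarith⟩ ⟨by linarith, by linarith⟩ (by linear_combination (-c) * i3)
    -- This compares the point (3 - τ, 2), where the ray meets the line y = 2, with the helix at
    -- that height.
    rcases lt_or_ge (2 * A) ((3 - τ) * B) with h7 | h7
    · obtain ⟨t₃, h8⟩ := h6.north (x' := 3 - τ) hG hc (by linarith) (by linarith) (by simp)
        ⟨by linarith, by linarith⟩ (by linear_combination (-2 * c) * i3)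
      refine T2.elim (t := t₃) (x := 3 - τ) (y := 2) (dx := -(τ * c)) (dy := c) ?_ (by linarith)
        (by linarith) le_rfl (by norm_num) (Or.inr hc.le) (by linarith) ?_ ?_ ?_ ?_
      · convert h8 using 1 <;> ring
      · linarith
      · have := mul_pos hc hA
        have := mul_pos hτc hB
        linarith
      · nlinarith
      · rw [div_mul_eq_mul_div, le_div_iff₀ hA]
        nlinarith [mul_pos hτc hB, mul_pos hc hA]
    -- The helix is met within the square at (0, 1). The starting point (1, y) lies below the
    -- boundary line, so `Trapped` does not apply and the meeting is computed directly.
    · set y := 1 + 2 * (1 / τ) with hy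
      have hD : 0 < c * A - -(τ * c) * B := by
        have := mul_pos hc hA
        have := mul_pos hτc hB
        linarith
      have hD' := hD.ne'
      have hs0 : 0 < (1 * B - y * A) / (c * A - -(τ * c) * B) := div_pos (by nlinarith) hD
      have hr1 : (1 * c - y * -(τ * c)) / (c * A - -(τ * c) * B) ≤ 2 / B := by
        rw [div_le_div_iff₀ hD hB]
        have : y * (τ * c) = τ * c + 2 * c := by rw [hy]; linear_combination (2 * c) * i3
        nlinarith
      have e2 : y + (1 * B - y * A) / (c * A - -(τ * c) * B) * c =
          (1 * c - y * -(τ * c)) / (c * A - -(τ * c) * B) * B := by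
        rw [div_mul_eq_mul_div, div_mul_eq_mul_div, eq_div_iff hD', add_mul,
          div_mul_cancel₀ _ hD']
        ring
      refine hit_in_square hγ hA hB hn R1 (by gcongr; norm_num) (by positivity)
        (by rw [div_mul_cancel₀ _ hB.ne']) E1 (t := t₂) (x := 1) (y := y) (dx := -(τ * c)) (dy := c)
        (s := (1 * B - y * A) / (c * A - -(τ * c) * B))
        (r := (1 * c - y * -(τ * c)) / (c * A - -(τ * c) * B))
        ?_ (by norm_num) (by norm_num) (by linarith) (by linarith) hs0 ?_ e2 ?_ hr1 hD ?_
      · convert h6 using 1 <;> ring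
      · rw [div_mul_eq_mul_div, div_mul_eq_mul_div, eq_div_iff hD', add_mul,
          div_mul_cancel₀ _ hD']
        ring
      · rw [div_le_div_iff₀ hB hD]
        nlinarith [mul_pos hτc hB, mul_pos hc hA]
      · rintro z hz x' y' rfl rfl - h8
        have h9 : z * c < (1 * B - y * A) / (c * A - -(τ * c) * B) * c := by
          have := hz.2; gcongr
        have h10 : (1 * c - y * -(τ * c)) / (c * A - -(τ * c) * B) * B ≤ 2 := by
          rwa [le_div_iff₀ hB] at hr1
        have h11 := mul_pos hz.1 hc
        rcases h8 with h8 | h8 <;> linarith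

/-- The start vertex reappears at (3, 3), and the boundary is the diagonal through (1, 1) and (2,
2). This lemma, too, serves the reflected segment. -/
theorem helix_three_three (hγ : IsSimpleClosedQuasigeodesic γ L) (hA : 0 < A) (hB : 0 < B)
    (hn : A ^ 2 + B ^ 2 = 1) (h0 : γ a = f.chart 0 0) (hf : HasForwardDir γ a (f.lin A B))
    (hm : A < B) (hm' : 3 * B < 4 * A)
    (R0 : Rep γ a A B f 0 0 0 (1 / B))
    (R1 : Rep γ a A B f.rollN 0 1 (1 / B) (1 / A))
    (R2 : Rep γ a A B f.rollN.rollE 1 1 (1 / A) (2 / B))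
    (R3 : Rep γ a A B f.rollN.rollE.rollN 1 2 (2 / B) (2 / A))
    (R4 : Rep γ a A B f.rollN.rollE.rollN.rollE 2 2 (2 / A) (3 / B))
    (R5 : Rep γ a A B f.rollN.rollE.rollN.rollE.rollN 2 3 (3 / B) (3 / A)) : False := by
  have hG := (hγ.good).reverse a
  have hβ : 0 < (1 : ℝ) * B - 1 * A := by linarith
  have T0 := Trapped.start hγ hA hB hn hβ R0 (by positivity)
    (Exit.north hB (by norm_num) (by linarith))
    (by rintro x y (rfl | rfl) (rfl | rfl) h1 h2 <;> linarith)
  have T1 := T0.north hγ hA hB hn hβ one_pos R1 (by norm_num)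
    (by rw [div_lt_div_iff₀ hB hA]; linarith) (Exit.east hA (by norm_num) (by linarith))
    (by rintro x y (rfl | rfl) (rfl | rfl) h1 h2 <;> linarith) (by norm_num) (by linarith)
  have T2 := T1.east hγ hA hB hn hβ one_pos R2 (by norm_num)
    (by rw [div_lt_div_iff₀ hA hB]; linarith) (Exit.north hB (by norm_num) (by linarith))
    (by rintro x y (rfl | rfl) (rfl | rfl) h1 h2 <;> linarith) (by norm_num) (by linarith)
    (by linarith)
  have T3 := T2.north hγ hA hB hn hβ one_pos R3 (by norm_num)
    (by rw [div_lt_div_iff₀ hB hA]; linarith) (Exit.east hA (by norm_num) (by linarith))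
    (by rintro x y (rfl | rfl) (rfl | rfl) h1 h2 <;> linarith) (by norm_num) (by linarith)
  have T4 := T3.east hγ hA hB hn hβ one_pos R4 (by norm_num)
    (by rw [div_lt_div_iff₀ hA hB]; linarith) (Exit.north hB (by norm_num) (by linarith))
    (by rintro x y (rfl | rfl) (rfl | rfl) h1 h2 <;> linarith) (by norm_num) (by linarith)
    (by linarith)
  have T5 := T4.north hγ hA hB hn hβ one_pos R5 (by norm_num)
    (by rw [div_lt_div_iff₀ hB hA]; linarith) (Exit.east hA (by norm_num) (by linarith))
    (by rintro x y (rfl | rfl) (rfl | rfl) h1 h2 <;> linarith) (by norm_num) (by linarith)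
  have e : f.rollN.rollE.rollN.rollE.rollN.rollE = f := by simp [Frame.rollE, Frame.rollN]
  have hs := CornerAt.start h0 hf
  rw [← e] at hs
  obtain ⟨c, d, hc, hd, hn', h1, h2⟩ := hs.south_west hγ hA hB hA hB.le T5 (by norm_num)
    (by norm_num) (by norm_num) (by norm_num) (by linarith)
  rcases lt_or_ge (1 * d) (1 * c) with h3 | h3
  · exact T4.not_south (p' := 3) hA hB one_pos hβ (by norm_num) (by norm_num) (by norm_num) (by norm_num)
      h2 hc hd h3
  have hc : 0 < c := by
    refine hc.lt_of_ne ?_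
    rintro rfl
    obtain rfl : d = 1 := by nlinarith
    linarith
  obtain ⟨τ, rfl⟩ : ∃ τ, d = τ * c := ⟨d / c, by field_simp⟩
  have hτ : 1 ≤ τ := le_of_mul_le_mul_right (by linarith) hc
  have hτ1 : τ * A ≤ B := le_of_mul_le_mul_right (by linarith) hc
  have hτ2 : τ < 4 / 3 := by nlinarith
  have hτ' : 0 < τ := by linarith
  have hτc : 0 < τ * c := by positivity
  rcases hτ.eq_or_lt with h5 | h5
  · subst h5
    obtain ⟨t₂, h6⟩ := h2.corner hG hc one_pos le_rfl (by simp) (by ring)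
    obtain ⟨c', d', hc', hd', h7, h8⟩ := h6.boundary hγ hA hB one_pos one_pos hβ hc
      (by ring) T3 T2 (by norm_num) (by norm_num) (by norm_num) (by norm_num)
      (by norm_num)
    obtain ⟨t₃, h9⟩ := h8.corner hG hc' one_pos le_rfl (by simp) (by linarith)
    obtain ⟨c₂, d₂, hc₂, hd₂, h10, h11⟩ := h9.boundary hγ hA hB one_pos one_pos hβ hc'
      h7 T1 T0 (by norm_num) (by norm_num) (by norm_num) (by norm_num)
      (by norm_num)
    obtain ⟨t₄, h12⟩ := h11.corner hG hc₂ one_pos le_rfl (by simp) (by linarith)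
    obtain ⟨rfl, rfl⟩ := h12.eq_start hγ h0 hf
    linarith
  · have i1 : 1 / τ < 1 := by rw [div_lt_iff₀ hτ']; linarith
    have i2 : 0 < 1 / τ := by positivity
    have i3 : 1 / τ * τ = 1 := by field_simp
    -- The quarter turn about (2, 2) takes (3 - 1/τ, 2) to (2, 1 + 1/τ); the ray then enters the
    -- strip at (3 - τ, 2).
    obtain ⟨t₂, h6⟩ := h2.turn (ξ := 1 - 1 / τ) hG hτc one_pos le_rfl (by simp)
      ⟨by linarith, by linarith⟩ (by linear_combination (-c) * i3)
    obtain ⟨t₃, h7⟩ := h6.north (x' := 2 - τ) hG hc (by linarith) (by linarith) (by simp)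
      ⟨by linarith, by linarith⟩ (by linear_combination (-c) * i3)
    refine T3.elim (t := t₃) (x := 3 - τ) (y := 2) (dx := -(τ * c)) (dy := c) ?_ (by linarith)
      (by linarith) le_rfl (by norm_num) (Or.inr hc.le) (by linarith) ?_ ?_ ?_ ?_
    · convert h7 using 1 <;> ring
    · nlinarith
    · have := mul_pos hc hA
      have := mul_pos hτc hB
      linarith
    · nlinarith
    · rw [div_mul_eq_mul_div, le_div_iff₀ hA]
      nlinarith [mul_pos hτc hB, mul_pos hc hA]

end

/-! ### Self-crossings and the classification of slopes. -/

theorem IsSimpleClosedQuasigeodesic.lin_eq {γ : ℝ → E3} {L a A B : ℝ}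
    (h : IsSimpleClosedQuasigeodesic γ L) {f f' : Frame} {p q p' q' r₀ r₁ r₀' r₁' r r' : ℝ}
    (hn : A ^ 2 + B ^ 2 = 1) (hR : Rep γ a A B f p q r₀ r₁) (hR' : Rep γ a A B f' p' q' r₀' r₁')
    (h0 : r₀ ≤ r) (h1 : r < r₁) (h0' : r₀' ≤ r') (h1' : r' < r₁')
    (e : f.chart (-p + r * A) (-q + r * B) = f'.chart (-p' + r' * A) (-q' + r' * B)) :
    f.lin A B = f'.lin A B :=
  h.forward_unique ((hR r ⟨h0, h1.le⟩).trans (e.trans (hR' r' ⟨h0', h1'.le⟩).symm))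
    (hR.forward hn h0 h1) (hR'.forward hn h0' h1')

section
variable {γ : ℝ → E3} {L a A B : ℝ} {f : Frame}

theorem Rep.swap {p q r r' : ℝ} (h : Rep γ a A B f p q r r') : Rep γ a B A f.swap q p r r' := by
  intro s hs
  rw [h s hs, f.chart_swap]

end

/-- The slope classification: a geodesic segment of slope at most one meets no face twice. -/
theorem crossings_of_slope_le_one {γ : ℝ → E3} {L a b A B : ℝ} {f : Frame}
    (hγ : IsSimpleClosedQuasigeodesic γ L) (hab : IsGeodesicSegment γ a b) (hB : 0 < B)
    (hBA : B ≤ A) (h0 : γ a = f.chart 0 0) (hf : HasForwardDir γ a (f.lin A B)) (i : Fin 3)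
    (c : Bool) : (faceCrossings γ a b i c).encard ≤ 1 := by
  have hA : 0 < A := hB.trans_le hBA
  have hn := f.norm_lin.1 hf.1
  have hG := hγ.good
  have hij := f.hij
  have hik := f.hik
  have hjk := f.hjk
  have hji := hij.symm
  have hki := hik.symm
  have hkj := hjk.symm
  have h0s : γ a = f.swap.chart 0 0 := by rw [h0, f.chart_swap]
  have hfs : HasForwardDir γ a (f.swap.lin B A) := by rwa [f.lin_swap]
  have hns : B ^ 2 + A ^ 2 = 1 := by rw [add_comm]; exact hn
  have n0 := Node.start h0 hf
  rcases hBA.eq_or_lt with h1 | h1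
  · exact n0.corner hG hA hB hab (by linarith) (by simp) i c
  obtain ⟨R0, n1⟩ := n0.east hG hA hB hn (zero_add 1) (by linarith) (by simp)
  rcases lt_trichotomy (2 * B) A with h2 | h2 | h2
  rotate_left
  · exact n1.corner hG hA hB hab (by linarith) (by simp [Frame.rollE, hik]) i c
  · obtain ⟨R1, n2⟩ := n1.north hG hA hB hn (zero_add 1) (by linarith) (by simp [Frame.rollE, *])
    obtain ⟨R2, n3⟩ := n2.east hG hA hB hn (show (1 : ℝ) + 1 = 2 by norm_num) (by linarith)
      (by simp [Frame.rollE, Frame.rollN, *])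
    rcases lt_trichotomy (3 * B) (2 * A) with h3 | h3 | h3
    · obtain ⟨R3, n4⟩ := n3.east hG hA hB hn (show (2 : ℝ) + 1 = 3 by norm_num) (by linarith)
        (by simp [Frame.rollE, Frame.rollN, *])
      obtain ⟨R4, n5⟩ := n4.north hG hA hB hn (show (1 : ℝ) + 1 = 2 by norm_num) (by linarith)
        (by simp [Frame.rollE, Frame.rollN, *])
      obtain ⟨R5, -⟩ := n5.east hG hA hB hn (show (3 : ℝ) + 1 = 4 by norm_num) (by linarith)
        (by simp [Frame.rollE, Frame.rollN, *])
      exact (helix_four_two hγ hA hB hn h0 hf h2 h3 R0 R1 R2 R3 R4 R5).elim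
    · exact n3.corner hG hA hB hab (by linarith) (by simp [Frame.rollE, Frame.rollN, *]) i c
    · obtain ⟨R3, n4⟩ := n3.north hG hA hB hn (show (1 : ℝ) + 1 = 2 by norm_num) (by linarith)
        (by simp [Frame.rollE, Frame.rollN, *])
      obtain ⟨R4, n5⟩ := n4.east hG hA hB hn (show (2 : ℝ) + 1 = 3 by norm_num) (by linarith)
        (by simp [Frame.rollE, Frame.rollN, *])
      rcases lt_trichotomy (4 * B) (3 * A) with h4 | h4 | h4
      -- Only the stages are followed from here, since the ray returns to the face of `f` in the
      -- square at (4, 3).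
      · obtain ⟨R5, -, n6⟩ := n5.1.east hG hA hB hn (show (3 : ℝ) + 1 = 4 by norm_num) (by linarith)
        obtain ⟨R6, -, n7⟩ := n6.north hG hA hB hn (show (2 : ℝ) + 1 = 3 by norm_num) (by linarith)
        obtain ⟨R7, -, -⟩ := n7.east hG hA hB hn (show (4 : ℝ) + 1 = 5 by norm_num) (by linarith)
        have e : f.rollE.rollN.rollE.rollN.rollE.rollE.rollN = f.flipX.swap := by
          simp [Frame.rollE, Frame.rollN, Frame.flipX, Frame.swap]
        rw [e] at R7
        -- The point (X, Y) of the square at (4, 3) is the point (4 - Y, X - 4) of `f`. Equating it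
        -- with (rA, rB) gives a linear system with orthogonal matrix, solved by these r and r'.
        have := hγ.lin_eq (r := 4 * A - 4 * B) (r' := 4 * A + 4 * B) hn R0 R7 (by linarith)
          (by rw [lt_div_iff₀ hA]; nlinarith) (by rw [div_le_iff₀ hB]; nlinarith)
          (by rw [lt_div_iff₀ hA]; nlinarith) (by
            rw [f.flipX.chart_swap, f.chart_flipX]; congr 1
            · linear_combination 4 * hn
            · linear_combination (-4) * hn)
        rw [f.flipX.lin_swap, f.lin_flipX] at this
        linarith [(f.lin_injective this).1]
      · exact n5.corner hG hA hB hab (by linarith) (by simp [Frame.rollE, Frame.rollN, *]) i c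
      · obtain ⟨R5, -⟩ := n5.north hG hA hB hn (show (2 : ℝ) + 1 = 3 by norm_num) (by linarith)
          (by simp [Frame.rollE, Frame.rollN, *])
        exact (helix_three_three hγ hB hA hns h0s hfs h1 h4 R0.swap R1.swap R2.swap R3.swap R4.swap
          R5.swap).elim
  · obtain ⟨R1, n2⟩ := n1.east hG hA hB hn (show (1 : ℝ) + 1 = 2 by norm_num) (by linarith)
      (by simp [Frame.rollE, *])
    rcases lt_trichotomy (3 * B) A with h3 | h3 | h3
    rotate_left
    · exact n2.corner hG hA hB hab (by linarith) (by simp [Frame.rollE, *]) i c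
    · obtain ⟨R2, n3⟩ := n2.north hG hA hB hn (zero_add 1) (by linarith)
        (by simp [Frame.rollE, *])
      obtain ⟨R3, n4⟩ := n3.east hG hA hB hn (show (2 : ℝ) + 1 = 3 by norm_num) (by linarith)
        (by simp [Frame.rollE, Frame.rollN, *])
      obtain ⟨R4, n5⟩ := n4.east hG hA hB hn (show (3 : ℝ) + 1 = 4 by norm_num) (by linarith)
        (by simp [Frame.rollE, Frame.rollN, *])
      rcases lt_trichotomy (5 * B) (2 * A) with h5 | h5 | h5
      rotate_left
      · exact n5.corner hG hA hB hab (by linarith) (by simp [Frame.rollE, Frame.rollN, *]) i c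
      · obtain ⟨R5, -⟩ := n5.north hG hA hB hn (show (1 : ℝ) + 1 = 2 by norm_num) (by linarith)
          (by simp [Frame.rollE, Frame.rollN, *])
        exact (helix_two_four hγ hB hA hns h0s hfs h2 h5 R0.swap R1.swap R2.swap R3.swap R4.swap
          R5.swap).elim
      · obtain ⟨R5, -, n6⟩ := n5.1.east hG hA hB hn (show (4 : ℝ) + 1 = 5 by norm_num) (by linarith)
        obtain ⟨R6, -, n7⟩ := n6.north hG hA hB hn (show (1 : ℝ) + 1 = 2 by norm_num) (by linarith)
        obtain ⟨R7, -, -⟩ := n7.east hG hA hB hn (show (5 : ℝ) + 1 = 6 by norm_num) (by linarith)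
        have e5 : f.rollE.rollE.rollN.rollE.rollE.rollE = f.rollE.flipX.swap := by
          simp [Frame.rollE, Frame.rollN, Frame.flipX, Frame.swap]
        have e7 : f.rollE.rollE.rollN.rollE.rollE.rollE.rollN = f.flipX.swap := by
          simp [Frame.rollE, Frame.rollN, Frame.flipX, Frame.swap]
        rw [e7] at R7
        rw [e5] at R6
        -- The crossing solves rA = 3 - r'B, rB = r'A - 5, and the quantity compared with 0 equals 1
        -- - rA. Its sign puts the crossing in the second square, on the common edge, or in the
        -- first square.
        rcases lt_trichotomy (B ^ 2 + 5 * A * B - 2 * A ^ 2) 0 with h6 | h6 | h6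
        · have := hγ.lin_eq (r := 3 * A - 5 * B) (r' := 3 * B + 5 * A) hn R1 R6
            (by rw [div_le_iff₀ hA]; nlinarith) (by rw [lt_div_iff₀ hA]; nlinarith)
            (by rw [div_le_iff₀ hA]; nlinarith) (by rw [lt_div_iff₀ hB]; nlinarith) (by
              rw [f.rollE.flipX.chart_swap, f.rollE.chart_flipX]
              congr 1
              · linear_combination 3 * hn
              · linear_combination (-5) * hn)
          rw [f.rollE.flipX.lin_swap, f.rollE.lin_flipX] at this
          linarith [(f.rollE.lin_injective this).1]
        · have e1 : 1 / A * A = 1 := by field_simp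
          have e2 : 2 / B * B = 2 := by field_simp
          have e3 : 1 / A * B = -5 + 2 / B * A := by field_simp; nlinarith
          have := hγ.lin_eq (r := 1 / A) (r' := 2 / B) hn R1 R7 le_rfl
            (by gcongr; norm_num) le_rfl (by rw [div_lt_div_iff₀ hB hA]; linarith) (by
              rw [f.flipX.chart_swap, f.chart_flipX, e1, e2, e3, neg_add_cancel, f.chart_rollE,
                ← e3]
              congr 1 <;> linarith)
          rw [f.flipX.lin_swap, f.lin_flipX] at this
          -- On the common edge one passage proceeds into the neighbouring face and so has a
          -- component normal to `f`; the other stays in `f`.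
          have := congrArg (fun w : E3 => w f.k) this
          rw [f.lin_k] at this
          have h7 : f.rollE.lin A B f.k = sg f.bk * A := f.rollE.lin_i A B
          rw [h7] at this
          exact (mul_ne_zero (sg_ne_zero _) hA.ne' this).elim
        · have := hγ.lin_eq (r := 3 * A - 5 * B) (r' := 3 * B + 5 * A) hn R0 R7
            (by linarith) (by rw [lt_div_iff₀ hA]; nlinarith)
            (by rw [div_le_iff₀ hB]; nlinarith) (by rw [lt_div_iff₀ hA]; nlinarith) (by
              rw [f.flipX.chart_swap, f.chart_flipX]
              congr 1
              · linear_combination 3 * hn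
              · linear_combination (-5) * hn)
          rw [f.flipX.lin_swap, f.lin_flipX] at this
          linarith [(f.lin_injective this).1]
    · rcases lt_trichotomy (4 * B) A with h4 | h4 | h4
      · obtain ⟨R2, n3⟩ := n2.east hG hA hB hn (show (2 : ℝ) + 1 = 3 by norm_num) (by linarith)
          (by simp [Frame.rollE, *])
        obtain ⟨R3, -⟩ := n3.east hG hA hB hn (show (3 : ℝ) + 1 = 4 by norm_num) (by linarith)
          (by simp [Frame.rollE, *])
        exact (helix_four hγ hA hB hn h0 hf h4 R0 R1 R2 R3).elim
      · obtain ⟨R2, n3⟩ := n2.east hG hA hB hn (show (2 : ℝ) + 1 = 3 by norm_num) (by linarith)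
          (by simp [Frame.rollE, *])
        exact n3.corner hG hA hB hab (by linarith) (by simp [Frame.rollE, *]) i c
      · obtain ⟨R2, n3⟩ := n2.east hG hA hB hn (show (2 : ℝ) + 1 = 3 by norm_num) (by linarith)
          (by simp [Frame.rollE, *])
        obtain ⟨R3, n4⟩ := n3.north hG hA hB hn (zero_add 1) (by linarith)
          (by simp [Frame.rollE, *])
        obtain ⟨R4, n5⟩ := n4.east hG hA hB hn (show (3 : ℝ) + 1 = 4 by norm_num) (by linarith)
          (by simp [Frame.rollE, Frame.rollN, *])
        obtain ⟨R5, -, -⟩ := n5.1.east hG hA hB hn (show (4 : ℝ) + 1 = 5 by norm_num) (by linarith)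
        have e : f.rollE.rollE.rollE.rollN.rollE = f.swap.flipX := by
          simp [Frame.rollE, Frame.rollN, Frame.flipX, Frame.swap]
        rw [e] at R5
        -- Here (X, Y) in the square at (4, 1) is the point (Y - 1, 5 - X) of `f`.
        have := hγ.lin_eq (r := 5 * B - A) (r' := 5 * A + B) hn R0 R5 (by linarith)
          (by rw [lt_div_iff₀ hA]; nlinarith) (by rw [div_le_iff₀ hA]; nlinarith)
          (by rw [lt_div_iff₀ hA]; nlinarith) (by
            rw [f.swap.chart_flipX, f.chart_swap]
            congr 1
            · linear_combination (-1) * hn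
            · linear_combination 5 * hn)
        rw [f.swap.lin_flipX, f.lin_swap] at this
        linarith [(f.lin_injective this).2]

/-! ### Normal position of the start, and the degenerate slope. -/

theorem exists_frame {p w : E3} (hp : IsVertex p) (hw : Tang p w) :
    ∃ (f : Frame) (A B : ℝ), p = f.chart 0 0 ∧ w = f.lin A B ∧ 0 ≤ B ∧ B ≤ A := by
  have hb : ∀ l, ∃ b : Bool, p l = val b 0 := by
    intro l
    rcases hp l with h | h
    · exact ⟨false, by simp [val, h]⟩
    · exact ⟨true, by simp [val, h]⟩
  choose b hb using hb
  have key : ∀ f : Frame, f.bi = b f.i → f.bj = b f.j → f.bk = b f.k → w f.k = 0 →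
      p = f.chart 0 0 ∧ w = f.lin (sg f.bi * w f.i) (sg f.bj * w f.j) := by
    intro f h1 h2 h3 h4
    constructor
    · apply f.ext_coord
      · rw [f.chart_i, h1, hb]
      · rw [f.chart_j, h2, hb]
      · rw [f.chart_k, h3, hb]
    · apply f.ext_coord
      · rw [f.lin_i, ← mul_assoc, sg_mul_self, one_mul]
      · rw [f.lin_j, ← mul_assoc, sg_mul_self, one_mul]
      · rw [f.lin_k, h4]
  obtain ⟨k, -, hk⟩ := hw.2.2
  obtain ⟨i, j, hij, hik, hjk⟩ : ∃ i j : Fin 3, i ≠ j ∧ i ≠ k ∧ j ≠ k := by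
    clear hk; revert k; decide
  have hi := hw.sg_nonneg (hb i)
  have hj := hw.sg_nonneg (hb j)
  rcases le_total (sg (b j) * w j) (sg (b i) * w i) with h | h
  · obtain ⟨h1, h2⟩ := key ⟨i, j, k, b i, b j, b k, hij, hik, hjk⟩ rfl rfl rfl hk
    exact ⟨_, _, _, h1, h2, hj, h⟩
  · obtain ⟨h1, h2⟩ := key ⟨j, i, k, b j, b i, b k, hij.symm, hjk, hik⟩ rfl rfl rfl hk
    exact ⟨_, _, _, h1, h2, hi, h⟩

/-- The arc follows an edge of the cube to the next vertex, so the list of faces met stays empty. -/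
theorem crossings_of_edge {γ : ℝ → E3} {a b : ℝ} {f : Frame} (hG : Good γ)
    (hab : IsGeodesicSegment γ a b) (h0 : γ a = f.chart 0 0)
    (hf : HasForwardDir γ a (f.lin 1 0)) (i : Fin 3) (c : Bool) :
    (faceCrossings γ a b i c).encard ≤ 1 := by
  have hv : ∀ s ∈ Ioo (0 : ℝ) 1, ¬ IsVertex (f.chart (0 + s * 1) (0 + s * 0)) := by
    intro s hs
    rw [f.isVertex_chart]
    rintro ⟨h | h, -⟩ <;> linarith [hs.1, hs.2]
  have hR := hG.travel (S := 1) h0 hf (by simp) (by simp) (by simp) (by simp) hv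
  have hz : ∀ r ∈ Icc (0 : ℝ) 1, ∀ i c, γ (a + r) ∉ openFace i c := by
    intro r hr
    rw [hR r hr]
    exact not_mem_openFace_of_edge (by simpa using hr) (by simp) (by simp)
  have hT : Trace γ a 1 [] := by
    refine ⟨fun r hr i c h => absurd h (hz r hr i c), fun r hr r' hr' i c h => absurd h (hz r hr i c),
      fun r hr => ?_⟩
    rw [hR r (Ioo_subset_Icc_self hr)]
    exact hv r hr
  refine hT.crossings_le_one hab one_pos ?_ i c
  rw [hR 1 (by simp), f.isVertex_chart]
  simp

end Cube


theorem mainTheorem3 (γ : ℝ → Cube.E3) (L : ℝ) (hγ : Cube.IsSimpleClosedQuasigeodesic γ L)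
    (a b : ℝ) (hab : Cube.IsGeodesicSegment γ a b) (i : Fin 3) (c : Bool) :
    (Cube.faceCrossings γ a b i c).encard ≤ 1 := by
  obtain ⟨w, hw⟩ := hab.start_dir
  obtain ⟨f, A, B, h0, rfl, hB, hBA⟩ := Cube.exists_frame hab.start_vertex
    (Cube.tang_of_forward hγ.on_surface hw)
  rcases hB.eq_or_lt with rfl | hB
  · have hn := f.norm_lin.1 hw.1
    obtain rfl : A = 1 := by nlinarith
    exact Cube.crossings_of_edge hγ.good hab h0 hw i c
  · exact Cube.crossings_of_slope_le_one hγ hab hB hBA h0 hw i c
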